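/- **Theorem (Correlation inequality).** Let $H_1,\dots,H_K\subset\mathbb R^M$ be linear subspaces, let $B_i:\mathbb R^M\to H_i$ be linear maps with $B_iB_i^T=I_{H_i}$ (the identity of $H_i$), and let $c_1,\dots,c_K\ge 0$ be constants such that $$\sum_{i=1}^K c_i\,B_i^TB_i=I_M .$$ Let $f_i:H_i\to[0,\infty)$, $i=1,\dots,K$, be measurable functions, and let $dv$ and $du$ denote Lebesgue measure on $\mathbb R^M$ and on $H_i$. Then $$\int_{\mathbb R^M}\prod_{i=1}^K f_i(B_iv)^{c_i}\,e^{-\pi|v|^2}\,dv\;\le\;\prod_{i=1}^K\Big(\int_{H_i}f_i(u)\,e^{-\pi|u|^2}\,du\Big)^{c_i}.$$ Moreover, for every $h\ge 0$ in $L^1(\mathbb R^M,e^{-\pi|v|^2}dv)$ with $\int_{\mathbb R^M}h\,e^{-\pi|v|^2}dv=1$, $$\int_{\mathbb R^M}h\log h\;e^{-\pi|v|^2}\,dv\;\ge\;\sum_{i=1}^K c_i\Big[\int_{\mathbb R^M}h(v)\log f_i(B_iv)\,e^{-\pi|v|^2}\,dv-\log\int_{H_i}f_i(u)\,e^{-\pi|u|^2}\,du\Big].$$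 If the left-hand side of this entropy inequality is finite and $\int_{H_i}f_i\,e^{-\pi|u|^2}du<\infty$, then the integral $\int h\log f_i(B_iv)\,e^{-\pi|v|^2}dv$ is well defined with value in $[-\infty,\infty)$ (its positive part is integrable). Integrals may be infinite, and both inequalities are understood in the extended reals with the conventions $\log 0=-\infty$, $\log\infty=\infty$, $0\cdot(\pm\infty)=0$, $0^0=\infty^0=1$; an indeterminate $\infty-\infty$ on the right-hand side of the entropy inequality is read as $-\infty$. -/

import Mathlib

open MeasureTheory
open scoped ENNReal

namespace BrascampLieb

/-- The measure `e^{-π|v|²} dv` on a finite-dimensional Euclidean space `E`, where `dv` is the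
Lebesgue measure of `E` (on a subspace: the one determined by the restricted inner product, for
which the cube spanned by an orthonormal basis has measure one). -/
noncomputable def gauss (E : Type*) [NormedAddCommGroup E] [InnerProductSpace ℝ E]
    [FiniteDimensional ℝ E] [MeasurableSpace E] [BorelSpace E] : Measure E :=
  (volume : Measure E).withDensity fun v => ENNReal.ofReal (Real.exp (-(Real.pi * ‖v‖ ^ 2)))

/-- The integral of an extended-real-valued function: the integral of its positive part minus the
integral of its negative part. It is the usual extended integral as soon as one of the two is
finite; an indeterminate `∞ - ∞` is read as `-∞`, as always in `EReal`. -/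
noncomputable def eintegral {E : Type*} [MeasurableSpace E] (μ : Measure E) (φ : E → EReal) :
    EReal :=
  ((∫⁻ v, (φ v).toENNReal ∂μ : ℝ≥0∞) : EReal) - ((∫⁻ v, (-φ v).toENNReal ∂μ : ℝ≥0∞) : EReal)

/-- The extended real number `a log b` for reals `a, b ≥ 0`, with `log 0 = -∞` and
`0 · (-∞) = 0`. -/
noncomputable def mulLog (a b : ℝ) : EReal :=
  (a : EReal) * ENNReal.log (ENNReal.ofReal b)

end BrascampLieb

namespace BrascampLieb

open Real Filter
open scoped InnerProductSpace Topology

/-! ### Gaussian measures: characteristic functions, linear images, translation. -/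

section Gauss

/-! Both inequalities are statements about the Gaussian probability measure; since `B i` has an
isometric adjoint, it maps the Gaussian of the whole space to the Gaussian of `H i`.

The proof of the first inequality is a discrete form of Borell's stochastic argument. Shifting the
Gaussian by `a` and applying Jensen gives, for every `a`, the lower bound `driftValue V x r a` for
`log ∫ exp (V (x + r z))` (`exp_driftValue_le`). Conversely, for small `r` one constant drift
attains the value up to `O(r ^ 4)` (`exists_drift_integral_exp_le`). For `V = ∑ c i * V i ∘ B i` the
drift value splits exactly into the values of the `V i` at the drifts `B i a`, because `∑ c i * ‖B i
a‖ ^ 2 = ‖a‖ ^ 2` (`driftValue_sum`). Taking the near-optimal drift for the sum and using its images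
as competitors for the `V i` gives the inequality at scale `r` with a factor `exp (C * r ^ 4)`.

The heat semigroup globalises this. One step moves scale `r ^ 2` from the outer Gaussian average
into the heat flows of the `f i` (`interpolation_step`). The flow preserves the regularity
constants, so `C` is the same at every step; with `n` steps and `r ^ 2 = 1 / n` the total error `exp
(C / n)` tends to `1`. General `f i` follow by approximation and Fatou.

The entropy inequality is dual to the first one: apply Young's inequality `a log b ≤ a log a - a +
b` with `a = h` and `b = P / Z`, where `P = ∏ (f i ∘ B i) ^ c i` and `Z` is the right-hand side of
the first inequality, so that `P / Z` has integral at most `1`. -/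

lemma measurable_gaussDensity {E : Type*} [NormedAddCommGroup E] [MeasurableSpace E]
    [BorelSpace E] :
    Measurable fun v : E => ENNReal.ofReal (exp (-(π * ‖v‖ ^ 2))) := by
  fun_prop

variable {E : Type*} [NormedAddCommGroup E] [InnerProductSpace ℝ E] [FiniteDimensional ℝ E]
  [MeasurableSpace E] [BorelSpace E]
  {F : Type*} [NormedAddCommGroup F] [InnerProductSpace ℝ F] [FiniteDimensional ℝ F]
  [MeasurableSpace F] [BorelSpace F]

lemma integral_gauss {G : Type*} [NormedAddCommGroup G] [NormedSpace ℝ G] (g : E → G) :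
    ∫ v, g v ∂(gauss E) = ∫ v, exp (-(π * ‖v‖ ^ 2)) • g v := by
  rw [gauss, integral_withDensity_eq_integral_toReal_smul measurable_gaussDensity
    (Filter.Eventually.of_forall fun _ => ENNReal.ofReal_lt_top)]
  simp only [ENNReal.toReal_ofReal (exp_pos _).le]

lemma integrable_gauss_iff {G : Type*} [NormedAddCommGroup G] [NormedSpace ℝ G] {g : E → G} :
    Integrable g (gauss E) ↔ Integrable (fun v => exp (-(π * ‖v‖ ^ 2)) • g v) := by
  rw [gauss, integrable_withDensity_iff_integrable_smul' measurable_gaussDensity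
    (Filter.Eventually.of_forall fun _ => ENNReal.ofReal_lt_top)]
  simp only [ENNReal.toReal_ofReal (exp_pos _).le]

lemma integrable_exp_neg_mul_sq_norm {b : ℝ} (hb : 0 < b) :
    Integrable fun v : E => exp (-(b * ‖v‖ ^ 2)) := by
  have h := GaussianFourier.integrable_cexp_neg_mul_sq_norm_add (V := E) (b := (b : ℂ))
    (by simpa using hb) 0 0
  have h2 := h.norm
  refine h2.congr (Filter.Eventually.of_forall fun v => ?_)
  simp only [Complex.norm_exp]
  congr 1
  simp [← Complex.ofReal_pow]

instance isProbabilityMeasure_gauss : IsProbabilityMeasure (gauss E) := by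
  constructor
  rw [gauss, withDensity_apply _ MeasurableSet.univ, Measure.restrict_univ,
    ← ofReal_integral_eq_lintegral_ofReal (integrable_exp_neg_mul_sq_norm pi_pos)
      (Filter.Eventually.of_forall fun _ => (exp_pos _).le)]
  have := GaussianFourier.integral_rexp_neg_mul_sq_norm (V := E) pi_pos
  simp only [neg_mul] at this
  rw [this, div_self pi_pos.ne']
  simp

lemma charFun_gauss (w : E) : charFun (gauss E) w = Complex.exp (-(‖w‖ ^ 2 / (4 * π))) := by
  rw [charFun_apply, integral_gauss]
  have h := GaussianFourier.integral_cexp_neg_mul_sq_norm_add (V := E) (b := (π : ℂ))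
    (by simpa using pi_pos) Complex.I w
  rw [div_self (by exact_mod_cast pi_pos.ne'), Complex.one_cpow, one_mul, Complex.I_sq] at h
  rw [show -((‖w‖ : ℂ) ^ 2 / (4 * π)) = -1 * ‖w‖ ^ 2 / (4 * π) by ring, ← h]
  congr 1 with v
  rw [Complex.real_smul, Complex.ofReal_exp, ← Complex.exp_add, real_inner_comm]
  push_cast
  congr 1
  ring

/-- The characteristic function of the image at `w` is that of the Gaussian at the adjoint image of
`w`. It depends only on the norm, which the adjoint preserves. -/
lemma map_gauss_of_adjoint_isometry (B : E →ₗ[ℝ] F)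
    (hB : B ∘ₗ LinearMap.adjoint B = LinearMap.id) : (gauss E).map B = gauss F := by
  have hBc : Continuous B := B.continuous_of_finiteDimensional
  have := Measure.isProbabilityMeasure_map (μ := gauss E) hBc.aemeasurable
  refine Measure.ext_of_charFun ?_
  ext w
  have hw : ‖LinearMap.adjoint B w‖ = ‖w‖ := by
    have : ⟪LinearMap.adjoint B w, LinearMap.adjoint B w⟫_ℝ = ⟪w, w⟫_ℝ := by
      rw [LinearMap.adjoint_inner_left]
      exact congrArg (fun T : F →ₗ[ℝ] F => ⟪w, T w⟫_ℝ) hB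
    rw [real_inner_self_eq_norm_sq, real_inner_self_eq_norm_sq] at this
    exact (sq_eq_sq₀ (norm_nonneg _) (norm_nonneg _)).1 this
  rw [charFun_gauss, ← hw, ← charFun_gauss, charFun_apply, charFun_apply,
    integral_map hBc.aemeasurable (by fun_prop)]
  simp only [LinearMap.adjoint_inner_right]

/-- Characteristic functions of independent summands multiply, so the squared scales add. This is
the source of the semigroup law. -/
lemma map_add_smul_prod_gauss (t r : ℝ) :
    ((gauss E).prod (gauss E)).map (fun p => t • p.1 + r • p.2)
      = (gauss E).map (fun z => √(t ^ 2 + r ^ 2) • z) := by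
  have h1 : Continuous fun p : E × E => t • p.1 + r • p.2 := by fun_prop
  have h2 : Continuous fun z : E => √(t ^ 2 + r ^ 2) • z := by fun_prop
  have := Measure.isProbabilityMeasure_map (μ := (gauss E).prod (gauss E)) h1.aemeasurable
  have := Measure.isProbabilityMeasure_map (μ := gauss E) h2.aemeasurable
  refine Measure.ext_of_charFun ?_
  ext w
  rw [charFun_map_smul, charFun_gauss, charFun_apply, integral_map h1.aemeasurable (by fun_prop)]
  have key : ∀ p : E × E, Complex.exp (⟪t • p.1 + r • p.2, w⟫_ℝ * Complex.I)
      = Complex.exp (⟪p.1, t • w⟫_ℝ * Complex.I) * Complex.exp (⟪p.2, r • w⟫_ℝ * Complex.I) := by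
    intro p
    rw [← Complex.exp_add, inner_add_left, real_inner_smul_left, real_inner_smul_left,
      real_inner_smul_right, real_inner_smul_right]
    push_cast
    congr 1
    ring
  simp only [key]
  rw [integral_prod_mul (fun z : E => Complex.exp (⟪z, t • w⟫_ℝ * Complex.I))
    (fun z : E => Complex.exp (⟪z, r • w⟫_ℝ * Complex.I)), ← charFun_apply, ← charFun_apply,
    charFun_gauss, charFun_gauss, ← Complex.exp_add]
  congr 1
  norm_cast
  rw [norm_smul, norm_smul, norm_smul, mul_pow, mul_pow, mul_pow, norm_eq_abs, norm_eq_abs,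
    norm_eq_abs, sq_abs, sq_abs, sq_abs, Real.sq_sqrt (by positivity)]
  ring

lemma integrable_exp_mul_norm_gauss (D : ℝ) : Integrable (fun z : E => exp (D * ‖z‖)) (gauss E) := by
  rw [integrable_gauss_iff]
  -- Half of the Gaussian exponent absorbs the linear term: `D‖v‖ ≤ D² + ‖v‖² / 4`.
  refine Integrable.mono' (g := fun v => exp (D ^ 2) * exp (-((π / 2) * ‖v‖ ^ 2)))
    ((integrable_exp_neg_mul_sq_norm (by positivity)).const_mul _) (by fun_prop)
    (Filter.Eventually.of_forall fun v => ?_)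
  rw [smul_eq_mul, ← exp_add, ← exp_add, norm_eq_abs, abs_of_pos (exp_pos _)]
  refine exp_le_exp.2 ?_
  nlinarith [sq_nonneg (D - ‖v‖ / 2), pi_gt_three, sq_nonneg ‖v‖, sq_nonneg D]

/-- A function of at most exponential growth is integrable. -/
lemma integrable_gauss_of_exp_growth {G : Type*} [NormedAddCommGroup G] [NormedSpace ℝ G]
    {g : E → G} (hg : AEStronglyMeasurable g (gauss E)) (A D : ℝ)
    (h : ∀ z, ‖g z‖ ≤ A * exp (D * ‖z‖)) : Integrable g (gauss E) :=
  ((integrable_exp_mul_norm_gauss D).const_mul A).mono' hg (Filter.Eventually.of_forall h)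

lemma integrable_inner_gauss (b : E) : Integrable (fun z => ⟪b, z⟫_ℝ) (gauss E) := by
  refine integrable_gauss_of_exp_growth (by fun_prop) ‖b‖ 1 fun z => ?_
  refine (norm_inner_le_norm b z).trans ?_
  gcongr
  linarith [add_one_le_exp (1 * ‖z‖)]

lemma integral_inner_gauss (b : E) : ∫ z, ⟪b, z⟫_ℝ ∂(gauss E) = 0 := by
  have h := integral_gauss (E := E) (fun z => ⟪b, z⟫_ℝ)
  have h2 := integral_neg_eq_self (fun z : E => exp (-(π * ‖z‖ ^ 2)) • ⟪b, z⟫_ℝ) volume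
  simp only [norm_neg, inner_neg_right, smul_neg, integral_neg] at h2
  linarith

/-- Translation of the Gaussian measure (Cameron-Martin). -/
lemma integral_gauss_translate (g : E → ℝ) (a : E) :
    ∫ z, g z ∂(gauss E)
      = ∫ z, exp (-(2 * π * ⟪a, z⟫_ℝ) - π * ‖a‖ ^ 2) * g (z + a) ∂(gauss E) := by
  rw [integral_gauss, integral_gauss,
    ← integral_add_right_eq_self (fun z : E => exp (-(π * ‖z‖ ^ 2)) • g z) a]
  congr 1 with z
  rw [smul_eq_mul, smul_eq_mul, ← mul_assoc, ← exp_add]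
  congr 2
  rw [norm_add_sq_real, real_inner_comm]
  ring

end Gauss

/-! ### Gaussian integrals at small scale and the optimal constant drift. -/

section Drift

variable {E : Type*} [NormedAddCommGroup E] [InnerProductSpace ℝ E]

/-- `V` is `L`-Lipschitz and admits first-order expansions with slope bounded by `L` and
remainder bounded by `L` times the square of the distance, at every point. -/
structure HasQuadraticExpansion (L : ℝ) (V : E → ℝ) : Prop where
  abs_sub_le : ∀ x y, |V y - V x| ≤ L * ‖y - x‖
  exists_slope : ∀ x, ∃ p : E, ‖p‖ ≤ L ∧ ∀ y, |V y - V x - ⟪p, y - x⟫_ℝ| ≤ L * ‖y - x‖ ^ 2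

namespace HasQuadraticExpansion

variable {L : ℝ} {V : E → ℝ}

lemma nonneg (hV : HasQuadraticExpansion L V) : 0 ≤ L := by
  obtain ⟨p, hp, -⟩ := hV.exists_slope 0
  exact (norm_nonneg p).trans hp

lemma continuous (hV : HasQuadraticExpansion L V) : Continuous V := by
  refine (LipschitzWith.of_dist_le_mul (K := ⟨L, hV.nonneg⟩) fun x y => ?_).continuous
  rw [dist_eq_norm, dist_eq_norm, Real.norm_eq_abs]
  exact hV.abs_sub_le y x

lemma abs_comp_le (hV : HasQuadraticExpansion L V) (x a : E) (r : ℝ) (z : E) :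
    |V (x + r • (z + a)) - V x| ≤ L * |r| * ‖a‖ + L * |r| * ‖z‖ := by
  have h := hV.abs_sub_le x (x + r • (z + a))
  rw [add_sub_cancel_left, norm_smul, Real.norm_eq_abs] at h
  have h2 := mul_le_mul_of_nonneg_left (norm_add_le z a) (mul_nonneg hV.nonneg (abs_nonneg r))
  linarith

variable [FiniteDimensional ℝ E] [MeasurableSpace E] [BorelSpace E]

lemma integrable_comp (hV : HasQuadraticExpansion L V) (x a : E) (r : ℝ) :
    Integrable (fun z => V (x + r • (z + a))) (gauss E) := by
  have hc := hV.continuous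
  have hL := hV.nonneg
  refine integrable_gauss_of_exp_growth (by fun_prop)
    (|V x| + L * |r| * ‖a‖ + L * |r|) 1 fun z => ?_
  have h1 := hV.abs_comp_le x a r z
  have h2 : |V (x + r • (z + a))| ≤ |V x| + |V (x + r • (z + a)) - V x| := by
    have := abs_add_le (V x) (V (x + r • (z + a)) - V x)
    rwa [add_sub_cancel] at this
  have h3 : (1 : ℝ) ≤ exp (1 * ‖z‖) := one_le_exp (by positivity)
  have h4 : ‖z‖ ≤ exp (1 * ‖z‖) := by linarith [add_one_le_exp (1 * ‖z‖)]
  have h5 : 0 ≤ |V x| + L * |r| * ‖a‖ := by positivity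
  have h6 : 0 ≤ L * |r| := by positivity
  rw [Real.norm_eq_abs]
  nlinarith [mul_le_mul_of_nonneg_left h3 h5, mul_le_mul_of_nonneg_left h4 h6]

/-- The value of the constant drift `a` in the variational formula for
`log ∫ exp (V (x + r z))`. -/
noncomputable def _root_.BrascampLieb.driftValue (V : E → ℝ) (x : E) (r : ℝ) (a : E) : ℝ :=
  ∫ z, V (x + r • (z + a)) ∂(gauss E) - π * ‖a‖ ^ 2

/-- The exponent of the translated integrand. -/
noncomputable def _root_.BrascampLieb.driftExponent (V : E → ℝ) (x : E) (r : ℝ) (a z : E) : ℝ :=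
  V (x + r • (z + a)) - 2 * π * ⟪a, z⟫_ℝ - π * ‖a‖ ^ 2

lemma integral_exp_eq (V : E → ℝ) (x : E) (r : ℝ) (a : E) :
    ∫ z, exp (V (x + r • z)) ∂(gauss E) = ∫ z, exp (driftExponent V x r a z) ∂(gauss E) := by
  rw [integral_gauss_translate _ a]
  congr 1 with z
  rw [← exp_add, driftExponent]
  congr 1
  ring

lemma integrable_driftExponent (hV : HasQuadraticExpansion L V) (x : E) (r : ℝ) (a : E) :
    Integrable (driftExponent V x r a) (gauss E) :=
  ((hV.integrable_comp x a r).sub ((integrable_inner_gauss a).const_mul _)).sub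
    (integrable_const _)

lemma integral_driftExponent (hV : HasQuadraticExpansion L V) (x : E) (r : ℝ) (a : E) :
    ∫ z, driftExponent V x r a z ∂(gauss E) = driftValue V x r a := by
  have h1 := hV.integrable_comp x a r
  have h2 := (integrable_inner_gauss a).const_mul (2 * π)
  simp only [driftExponent, driftValue]
  rw [integral_sub (f := fun z => V (x + r • (z + a)) - 2 * π * ⟪a, z⟫_ℝ) (h1.sub h2)
    (integrable_const _), integral_sub h1 h2, integral_const_mul, integral_inner_gauss]
  simp

lemma integrable_exp_driftExponent (hV : HasQuadraticExpansion L V) (x : E) (r : ℝ) (a : E) :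
    Integrable (fun z => exp (driftExponent V x r a z)) (gauss E) := by
  have hc := hV.continuous
  refine integrable_gauss_of_exp_growth (by unfold driftExponent; fun_prop)
    (exp (V x + L * |r| * ‖a‖)) (L * |r| + 2 * π * ‖a‖) fun z => ?_
  rw [Real.norm_eq_abs, abs_of_pos (exp_pos _), ← exp_add, driftExponent]
  refine exp_le_exp.2 ?_
  have h1 := (abs_le.1 (hV.abs_comp_le x a r z)).2
  have h2 := (abs_le.1 (abs_real_inner_le_norm a z)).1
  have h3 : 0 ≤ π * ‖a‖ ^ 2 := by positivity
  have h4 := mul_le_mul_of_nonneg_left h2 (show 0 ≤ 2 * π by positivity)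
  linarith

/-- Jensen's inequality for `exp` after the shift by `a`, proved by integrating the tangent line of
`exp` at the mean `J` of the exponent. -/
lemma exp_driftValue_le (hV : HasQuadraticExpansion L V) (x : E) (r : ℝ) (a : E) :
    exp (driftValue V x r a) ≤ ∫ z, exp (V (x + r • z)) ∂(gauss E) := by
  rw [integral_exp_eq V x r a]
  set J := driftValue V x r a with hJ
  have h1 := hV.integrable_driftExponent x r a
  have h2 : ∫ z, exp J * (driftExponent V x r a z - J + 1) ∂(gauss E) = exp J := by
    rw [integral_const_mul, integral_add (f := fun z => driftExponent V x r a z - J)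
      (h1.sub (integrable_const _)) (integrable_const _), integral_sub h1 (integrable_const _), hV.integral_driftExponent]
    simp [← hJ]
  rw [← h2]
  refine integral_mono (((h1.sub (integrable_const _)).add (integrable_const _)).const_mul _)
    (hV.integrable_exp_driftExponent x r a) fun z => ?_
  calc exp J * (driftExponent V x r a z - J + 1)
      ≤ exp J * exp (driftExponent V x r a z - J) := by
        gcongr; exact add_one_le_exp _
    _ = exp (driftExponent V x r a z) := by rw [← exp_add, add_sub_cancel]

lemma _root_.BrascampLieb.exp_le_one_add_add_sq_mul_exp_abs (t : ℝ) :
    exp t ≤ 1 + t + t ^ 2 * exp |t| := by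
  have h1 : exp t - 1 ≤ t * exp t := by
    have h := mul_le_mul_of_nonneg_left (add_one_le_exp (-t)) (exp_pos t).le
    rw [← exp_add, add_neg_cancel, exp_zero] at h
    linarith
  have h2 : t * (exp t - 1) ≤ t ^ 2 * exp |t| := by
    rcases le_total 0 t with ht | ht
    · rw [abs_of_nonneg ht]
      nlinarith [mul_le_mul_of_nonneg_left h1 ht]
    · have h3 := mul_le_mul_of_nonpos_left (show t ≤ exp t - 1 by linarith [add_one_le_exp t]) ht
      have h4 : 1 ≤ exp |t| := one_le_exp (abs_nonneg t)
      nlinarith [mul_le_mul_of_nonneg_left h4 (sq_nonneg t)]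
  linarith

/-- The constant in the error term of `exists_drift_integral_exp_le`. -/
noncomputable def _root_.BrascampLieb.driftConst (E : Type*) [NormedAddCommGroup E]
    [InnerProductSpace ℝ E] [FiniteDimensional ℝ E] [MeasurableSpace E] [BorelSpace E]
    (L : ℝ) : ℝ :=
  ∫ z : E, 24 * L ^ 2 * exp ((2 * L + 1) * L) * exp ((2 * L + 1) * ‖z‖) ∂(gauss E)

/-- For small `r` there is a constant drift that is optimal up to an error of order `r ^ 4`. -/
lemma exists_drift_integral_exp_le (hV : HasQuadraticExpansion L V) (x : E) {r : ℝ} (hr : 0 ≤ r)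
    (hr1 : r ≤ 1) :
    ∃ a : E, ∫ z, exp (V (x + r • z)) ∂(gauss E)
      ≤ exp (driftValue V x r a + driftConst E L * r ^ 4) := by
  obtain ⟨p, hpL, hp⟩ := hV.exists_slope x
  have hL := hV.nonneg
  have hpi := pi_pos
  -- The maximiser of `r⟪p, a⟫ - π‖a‖²`, the drift value with `V` replaced by its expansion at `x`.
  set a : E := (r / (2 * π)) • p with ha
  have hra : r • p = (2 * π) • a := by
    rw [ha, smul_smul]; congr 1; field_simp
  have haL : ‖a‖ ≤ L := by
    rw [ha, norm_smul, Real.norm_eq_abs, abs_of_nonneg (by positivity)]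
    have : r / (2 * π) ≤ 1 := by
      rw [div_le_one (by positivity)]; linarith [pi_gt_three]
    exact (mul_le_mul this hpL (norm_nonneg _) zero_le_one).trans_eq (one_mul L)
  refine ⟨a, ?_⟩
  -- For this drift the terms linear in `z` cancel, so up to a constant the exponent is just the
  -- Taylor remainder `R` of `V` at `x`.
  set R : E → ℝ := fun z => driftExponent V x r a z - (V x + π * ‖a‖ ^ 2) with hR
  have hReq : ∀ z, R z = V (x + r • (z + a)) - V x - ⟪p, (x + r • (z + a)) - x⟫_ℝ := by
    intro z
    have : ⟪p, r • (z + a)⟫_ℝ = 2 * π * ⟪a, z⟫_ℝ + 2 * π * ‖a‖ ^ 2 := by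
      rw [real_inner_smul_right, ← real_inner_smul_left, hra, real_inner_smul_left,
        inner_add_right, real_inner_self_eq_norm_sq]
      ring
    rw [add_sub_cancel_left, this, hR]
    simp only [driftExponent]
    ring
  have hRi : Integrable R (gauss E) := (hV.integrable_driftExponent x r a).sub (integrable_const _)
  -- `R` is bounded in two ways. The quadratic bound makes `R ^ 2` of order `r ^ 4`; the linear
  -- bound `2 * L * s` is used inside `exp |R|`, so that the result has only exponential growth and
  -- is integrable. The factor 24 is `4!`, from `s ^ 4 ≤ 4! * exp s`.
  have hRbound : ∀ z, exp (R z) ≤ 1 + R z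
      + r ^ 4 * (24 * L ^ 2 * exp ((2 * L + 1) * L) * exp ((2 * L + 1) * ‖z‖)) := by
    intro z
    set s := ‖z‖ + L with hs
    have hs0 : 0 ≤ s := by positivity
    have hza : ‖z + a‖ ≤ s := by linarith [norm_add_le z a]
    have hn : ‖(x + r • (z + a)) - x‖ = r * ‖z + a‖ := by
      rw [add_sub_cancel_left, norm_smul, Real.norm_eq_abs, abs_of_nonneg hr]
    have h1 : |R z| ≤ L * r ^ 2 * s ^ 2 := by
      rw [hReq]
      refine (hp _).trans ?_
      rw [hn, mul_pow, ← mul_assoc]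
      gcongr
    have h2 : |R z| ≤ 2 * L * s := by
      rw [hReq]
      have e1 := hV.abs_sub_le x (x + r • (z + a))
      have e2 := abs_real_inner_le_norm p ((x + r • (z + a)) - x)
      have e3 := abs_sub (V (x + r • (z + a)) - V x) ⟪p, (x + r • (z + a)) - x⟫_ℝ
      have e4 : ‖(x + r • (z + a)) - x‖ ≤ s := by
        rw [hn]
        exact (mul_le_mul hr1 hza (norm_nonneg _) zero_le_one).trans_eq (one_mul s)
      have e5 := mul_le_mul hpL e4 (norm_nonneg _) hL
      have e6 := mul_le_mul_of_nonneg_left e4 hL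
      linarith
    have h3 : R z ^ 2 ≤ L ^ 2 * r ^ 4 * s ^ 4 := by
      rw [← sq_abs]
      calc |R z| ^ 2 ≤ (L * r ^ 2 * s ^ 2) ^ 2 := by gcongr
        _ = L ^ 2 * r ^ 4 * s ^ 4 := by ring
    have h4 : s ^ 4 ≤ 24 * exp s := by
      have := pow_div_factorial_le_exp s hs0 4
      have h24 : ((Nat.factorial 4 : ℕ) : ℝ) = 24 := by norm_num [Nat.factorial]
      rw [h24, div_le_iff₀ (by norm_num)] at this
      linarith
    refine (exp_le_one_add_add_sq_mul_exp_abs (R z)).trans (add_le_add_right ?_ _)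
    have h5 : exp s * exp (2 * L * s) = exp ((2 * L + 1) * L) * exp ((2 * L + 1) * ‖z‖) := by
      rw [← exp_add, ← exp_add, hs]
      congr 1
      ring
    calc R z ^ 2 * exp |R z| ≤ (L ^ 2 * r ^ 4 * (24 * exp s)) * exp (2 * L * s) := by
          gcongr
          exact h3.trans (by gcongr)
      _ = r ^ 4 * (24 * L ^ 2 * (exp s * exp (2 * L * s))) := by ring
      _ = _ := by rw [h5]; ring
  have hexp : ∀ z, exp (driftExponent V x r a z) = exp (V x + π * ‖a‖ ^ 2) * exp (R z) := by
    intro z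
    rw [← exp_add, hR]
    simp only [add_sub_cancel]
  have hci : Integrable (fun z : E => 24 * L ^ 2 * exp ((2 * L + 1) * L) * exp ((2 * L + 1) * ‖z‖))
    (gauss E) := (integrable_exp_mul_norm_gauss _).const_mul _
  have hi1 : Integrable (fun z => 1 + R z) (gauss E) := (integrable_const _).add hRi
  have hRint : ∫ z, R z ∂(gauss E) = driftValue V x r a - (V x + π * ‖a‖ ^ 2) := by
    rw [hR, integral_sub (hV.integrable_driftExponent x r a) (integrable_const _),
      hV.integral_driftExponent]
    simp
  have hRe : Integrable (fun z => exp (R z)) (gauss E) := by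
    have h := (hV.integrable_exp_driftExponent x r a).const_mul (exp (-(V x + π * ‖a‖ ^ 2)))
    refine h.congr (Filter.Eventually.of_forall fun z => ?_)
    simp only [← exp_add, hR]
    congr 1
    ring
  rw [integral_exp_eq V x r a]
  simp only [hexp]
  rw [integral_const_mul]
  -- The mean of `R` is not small enough to be discarded, but it is exactly the drift value minus
  -- the constant; `1 + t ≤ exp t` then returns it to the exponent.
  have hle : ∫ z, exp (R z) ∂(gauss E)
      ≤ 1 + (driftValue V x r a - (V x + π * ‖a‖ ^ 2)) + r ^ 4 * driftConst E L := by
    refine (integral_mono hRe (hi1.add (hci.const_mul (r ^ 4))) hRbound).trans_eq ?_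
    rw [integral_add' hi1 (hci.const_mul (r ^ 4)), integral_add (integrable_const _) hRi, hRint,
      integral_const_mul, driftConst]
    simp
  calc exp (V x + π * ‖a‖ ^ 2) * ∫ z, exp (R z) ∂(gauss E)
      ≤ exp (V x + π * ‖a‖ ^ 2)
        * exp (driftValue V x r a - (V x + π * ‖a‖ ^ 2) + r ^ 4 * driftConst E L) := by
        gcongr
        refine hle.trans ((le_of_eq ?_).trans (add_one_le_exp _))
        ring
    _ = _ := by
        rw [← exp_add]
        congr 1
        ring

end HasQuadraticExpansion

end Drift

/-! ### Geometric data and the inequality at small scale. -/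

/-- The data of a geometric Brascamp-Lieb inequality. -/
structure IsGeometricDatum {ι : Type*} [Fintype ι] {E : Type*} [NormedAddCommGroup E]
    [InnerProductSpace ℝ E] [FiniteDimensional ℝ E] {F : ι → Type*}
    [∀ i, NormedAddCommGroup (F i)] [∀ i, InnerProductSpace ℝ (F i)]
    [∀ i, FiniteDimensional ℝ (F i)] (B : ∀ i, E →ₗ[ℝ] F i) (c : ι → ℝ) : Prop where
  comp_adjoint : ∀ i, B i ∘ₗ LinearMap.adjoint (B i) = LinearMap.id
  nonneg : ∀ i, 0 ≤ c i
  sum_adjoint_comp : ∑ i, c i • (LinearMap.adjoint (B i) ∘ₗ B i) = LinearMap.id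

namespace IsGeometricDatum

variable {ι : Type*} [Fintype ι] {E : Type*} [NormedAddCommGroup E] [InnerProductSpace ℝ E]
  [FiniteDimensional ℝ E] {F : ι → Type*} [∀ i, NormedAddCommGroup (F i)]
  [∀ i, InnerProductSpace ℝ (F i)] [∀ i, FiniteDimensional ℝ (F i)]
  {B : ∀ i, E →ₗ[ℝ] F i} {c : ι → ℝ}

lemma norm_adjoint (hB : IsGeometricDatum B c) (i : ι) (w : F i) :
    ‖LinearMap.adjoint (B i) w‖ = ‖w‖ := by
  have : ⟪LinearMap.adjoint (B i) w, LinearMap.adjoint (B i) w⟫_ℝ = ⟪w, w⟫_ℝ := by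
    rw [LinearMap.adjoint_inner_left]
    exact congrArg (fun T : F i →ₗ[ℝ] F i => ⟪w, T w⟫_ℝ) (hB.comp_adjoint i)
  rw [real_inner_self_eq_norm_sq, real_inner_self_eq_norm_sq] at this
  exact (sq_eq_sq₀ (norm_nonneg _) (norm_nonneg _)).1 this

lemma norm_apply_le (hB : IsGeometricDatum B c) (i : ι) (v : E) : ‖B i v‖ ≤ ‖v‖ := by
  have h : ‖B i v‖ ^ 2 ≤ ‖B i v‖ * ‖v‖ := by
    rw [← real_inner_self_eq_norm_sq, ← LinearMap.adjoint_inner_left]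
    exact (real_inner_le_norm _ _).trans_eq (by rw [hB.norm_adjoint])
  rcases (norm_nonneg (B i v)).eq_or_lt with h0 | h0
  · rw [← h0]; exact norm_nonneg v
  · rw [sq] at h
    exact le_of_mul_le_mul_left h h0

lemma sum_mul_norm_sq (hB : IsGeometricDatum B c) (v : E) :
    ∑ i, c i * ‖B i v‖ ^ 2 = ‖v‖ ^ 2 := by
  have h := congrArg (fun T : E →ₗ[ℝ] E => ⟪T v, v⟫_ℝ) hB.sum_adjoint_comp
  simp only [LinearMap.sum_apply, LinearMap.smul_apply, LinearMap.comp_apply, LinearMap.id_apply,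
    sum_inner, real_inner_smul_left, LinearMap.adjoint_inner_left, real_inner_self_eq_norm_sq] at h
  exact h

/-- Each `B i` is a contraction with isometric adjoint, so expansions pull back without loss in the
constants. -/
lemma hasQuadraticExpansion_sum (hB : IsGeometricDatum B c) {L : ι → ℝ} {V : ∀ i, F i → ℝ}
    (hV : ∀ i, HasQuadraticExpansion (L i) (V i)) :
    HasQuadraticExpansion (∑ i, c i * L i) fun v => ∑ i, c i * V i (B i v) := by
  constructor
  · intro x y
    rw [← Finset.sum_sub_distrib, Finset.sum_mul]
    refine (Finset.abs_sum_le_sum_abs _ _).trans (Finset.sum_le_sum fun i _ => ?_)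
    rw [← mul_sub, abs_mul, abs_of_nonneg (hB.nonneg i), mul_assoc]
    refine mul_le_mul_of_nonneg_left (((hV i).abs_sub_le _ _).trans ?_) (hB.nonneg i)
    rw [← map_sub]
    exact mul_le_mul_of_nonneg_left (hB.norm_apply_le i _) (hV i).nonneg
  · intro x
    choose p hpL hp using fun i => (hV i).exists_slope (B i x)
    refine ⟨∑ i, c i • LinearMap.adjoint (B i) (p i), ?_, fun y => ?_⟩
    · refine (norm_sum_le _ _).trans (Finset.sum_le_sum fun i _ => ?_)
      rw [norm_smul, Real.norm_eq_abs, abs_of_nonneg (hB.nonneg i), hB.norm_adjoint]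
      exact mul_le_mul_of_nonneg_left (hpL i) (hB.nonneg i)
    · simp only [sum_inner, real_inner_smul_left, LinearMap.adjoint_inner_left]
      rw [← Finset.sum_sub_distrib, ← Finset.sum_sub_distrib, Finset.sum_mul]
      refine (Finset.abs_sum_le_sum_abs _ _).trans (Finset.sum_le_sum fun i _ => ?_)
      rw [← mul_sub, ← mul_sub, abs_mul, abs_of_nonneg (hB.nonneg i), mul_assoc, map_sub]
      refine mul_le_mul_of_nonneg_left ((hp i (B i y)).trans ?_) (hB.nonneg i)
      refine mul_le_mul_of_nonneg_left ?_ (hV i).nonneg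
      rw [← map_sub]
      gcongr
      exact hB.norm_apply_le i _

variable [MeasurableSpace E] [BorelSpace E] [∀ i, MeasurableSpace (F i)] [∀ i, BorelSpace (F i)]

lemma measurePreserving (hB : IsGeometricDatum B c) (i : ι) :
    MeasurePreserving (B i) (gauss E) (gauss (F i)) :=
  ⟨(B i).continuous_of_finiteDimensional.measurable,
    map_gauss_of_adjoint_isometry (B i) (hB.comp_adjoint i)⟩

/-- The two conditions on `B` meet here: the Gaussian averages of `V i ∘ B i` are averages over `F
i`, and the quadratic cost of `a` is exactly the weighted sum of the costs of the `B i a`. -/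
lemma driftValue_sum (hB : IsGeometricDatum B c) {L : ι → ℝ} {V : ∀ i, F i → ℝ}
    (hV : ∀ i, HasQuadraticExpansion (L i) (V i)) (x a : E) (r : ℝ) :
    driftValue (fun v => ∑ i, c i * V i (B i v)) x r a
      = ∑ i, c i * driftValue (V i) (B i x) r (B i a) := by
  have key : ∀ i, ∫ z, V i (B i x + r • (z + B i a)) ∂(gauss (F i))
      = ∫ z, V i (B i (x + r • (z + a))) ∂(gauss E) := by
    intro i
    have hc := (hV i).continuous
    rw [← (hB.measurePreserving i).map_eq,
      integral_map (hB.measurePreserving i).aemeasurable (by fun_prop)]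
    simp only [map_add, map_smul]
  have hint : ∀ i, Integrable (fun z => V i (B i (x + r • (z + a)))) (gauss E) := by
    intro i
    have := (hB.measurePreserving i).integrable_comp_of_integrable
      ((hV i).integrable_comp (B i x) (B i a) r)
    refine this.congr (Filter.Eventually.of_forall fun z => ?_)
    simp only [Function.comp, map_add, map_smul]
  simp only [driftValue, key, mul_sub, Finset.sum_sub_distrib]
  rw [integral_finsetSum _ fun i _ => (hint i).const_mul (c i)]
  simp only [integral_const_mul]
  rw [← hB.sum_mul_norm_sq a, Finset.mul_sum]
  congr 1
  exact Finset.sum_congr rfl fun i _ => by ring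

/-- The Brascamp-Lieb inequality for a Gaussian of small variance `r ^ 2`, up to an error of
order `r ^ 4`. -/
lemma integral_exp_le_of_small (hB : IsGeometricDatum B c) {L : ι → ℝ} {V : ∀ i, F i → ℝ}
    (hV : ∀ i, HasQuadraticExpansion (L i) (V i)) (x : E) {r : ℝ} (hr : 0 ≤ r) (hr1 : r ≤ 1) :
    ∫ z, exp (∑ i, c i * V i (B i (x + r • z))) ∂(gauss E)
      ≤ exp (driftConst E (∑ i, c i * L i) * r ^ 4)
        * ∏ i, (∫ z, exp (V i (B i x + r • z)) ∂(gauss (F i))) ^ c i := by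
  obtain ⟨a, ha⟩ := (hB.hasQuadraticExpansion_sum hV).exists_drift_integral_exp_le x hr hr1
  refine ha.trans ?_
  rw [add_comm, exp_add, hB.driftValue_sum hV, exp_sum]
  gcongr with i _
  rw [mul_comm, exp_mul]
  -- The lower bound holds for every drift, so `B i a` may be used although it need not be
  -- near-optimal for `V i`.
  exact rpow_le_rpow (exp_pos _).le ((hV i).exp_driftValue_le _ _ _) (hB.nonneg i)

end IsGeometricDatum

/-! ### Regular functions and the heat semigroup. -/

section Heat

variable {E : Type*} [NormedAddCommGroup E] [InnerProductSpace ℝ E]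

/-- `f` is bounded between the positive constants `m` and `N`, and has first-order expansions
with bounded slope `q` and quadratic remainder. -/
structure IsRegular (m N L : ℝ) (f : E → ℝ) (q : E → E) : Prop where
  pos : 0 < m
  le : ∀ x, m ≤ f x
  ge : ∀ x, f x ≤ N
  abs_sub_le : ∀ x y, |f y - f x| ≤ L * ‖y - x‖
  norm_slope_le : ∀ x, ‖q x‖ ≤ L
  continuous_slope : Continuous q
  abs_expansion_le : ∀ x y, |f y - f x - ⟪q x, y - x⟫_ℝ| ≤ L * ‖y - x‖ ^ 2

lemma abs_log_sub_log_le {m a b : ℝ} (hm : 0 < m) (ha : m ≤ a) (hb : m ≤ b) :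
    |log b - log a| ≤ |b - a| / m := by
  have key : ∀ {a b : ℝ}, m ≤ a → m ≤ b → log b - log a ≤ |b - a| / m := by
    intro a b ha hb
    have ha0 := hm.trans_le ha
    have hb0 := hm.trans_le hb
    rw [← log_div hb0.ne' ha0.ne']
    refine (log_le_sub_one_of_pos (by positivity)).trans ?_
    rw [div_sub_one ha0.ne']
    exact div_le_div₀ (abs_nonneg _) (le_abs_self _) hm ha
  rw [abs_le]
  exact ⟨by have := key hb ha; rw [abs_sub_comm] at this; linarith, key ha hb⟩

lemma abs_log_sub_log_sub_div_le {m a b : ℝ} (hm : 0 < m) (ha : m ≤ a) (hb : m ≤ b) :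
    |log b - log a - (b - a) / a| ≤ (b - a) ^ 2 / m ^ 2 := by
  have ha0 := hm.trans_le ha
  have hb0 := hm.trans_le hb
  have h1 : log b - log a ≤ (b - a) / a := by
    rw [← log_div hb0.ne' ha0.ne', ← div_sub_one ha0.ne']
    exact log_le_sub_one_of_pos (by positivity)
  have h2 : (b - a) / b ≤ log b - log a := by
    have h := log_le_sub_one_of_pos (show 0 < a / b by positivity)
    rw [log_div ha0.ne' hb0.ne', div_sub_one hb0.ne'] at h
    have : (b - a) / b = -((a - b) / b) := by ring
    linarith
  rw [abs_of_nonpos (by linarith)]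
  have h3 : (b - a) / a - (b - a) / b = (b - a) ^ 2 / (a * b) := by field_simp
  have h4 : (b - a) ^ 2 / (a * b) ≤ (b - a) ^ 2 / m ^ 2 := by
    rw [sq m]
    gcongr
  linarith

namespace IsRegular

variable {m N L : ℝ} {f : E → ℝ} {q : E → E}

lemma nonneg (hf : IsRegular m N L f q) : 0 ≤ L :=
  (norm_nonneg _).trans (hf.norm_slope_le 0)

lemma continuous (hf : IsRegular m N L f q) : Continuous f := by
  refine (LipschitzWith.of_dist_le_mul (K := ⟨L, hf.nonneg⟩) fun x y => ?_).continuous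
  rw [dist_eq_norm, dist_eq_norm, Real.norm_eq_abs]
  exact hf.abs_sub_le y x

lemma abs_le_upper (hf : IsRegular m N L f q) (x : E) : |f x| ≤ N := by
  rw [abs_of_pos (hf.pos.trans_le (hf.le x))]
  exact hf.ge x

/-- The slope is `q / f`. The constant depends only on `m` and `L`, hence stays fixed along the heat
flow; the `L ^ 2 / m ^ 2` part is the second-order error of the logarithm. -/
lemma hasQuadraticExpansion_log (hf : IsRegular m N L f q) :
    HasQuadraticExpansion (L / m + L ^ 2 / m ^ 2) fun x => log (f x) := by
  have hm := hf.pos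
  have hL := hf.nonneg
  constructor
  · intro x y
    refine (abs_log_sub_log_le hm (hf.le x) (hf.le y)).trans ?_
    have h1 : |f y - f x| / m ≤ L * ‖y - x‖ / m := by
      gcongr
      exact hf.abs_sub_le x y
    have h2 : 0 ≤ L ^ 2 / m ^ 2 * ‖y - x‖ := by positivity
    calc _ ≤ _ := h1
      _ = L / m * ‖y - x‖ := by ring
      _ ≤ _ := by rw [add_mul]; linarith
  · intro x
    have hx := hm.trans_le (hf.le x)
    refine ⟨(f x)⁻¹ • q x, ?_, fun y => ?_⟩
    · rw [norm_smul, norm_inv, Real.norm_eq_abs, abs_of_pos hx, inv_mul_eq_div]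
      have h1 : ‖q x‖ / f x ≤ L / m := div_le_div₀ hL (hf.norm_slope_le x) hm (hf.le x)
      have h2 : 0 ≤ L ^ 2 / m ^ 2 := by positivity
      linarith
    · rw [real_inner_smul_left, inv_mul_eq_div]
      have h1 := abs_log_sub_log_sub_div_le hm (hf.le x) (hf.le y)
      have h2 : |(f y - f x) / f x - ⟪q x, y - x⟫_ℝ / f x| ≤ L / m * ‖y - x‖ ^ 2 := by
        rw [← sub_div, abs_div, abs_of_pos hx, div_mul_eq_mul_div]
        exact div_le_div₀ (by positivity) (hf.abs_expansion_le x y) hm (hf.le x)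
      have h3 : (f y - f x) ^ 2 / m ^ 2 ≤ L ^ 2 / m ^ 2 * ‖y - x‖ ^ 2 := by
        rw [div_mul_eq_mul_div, ← mul_pow, ← sq_abs (f y - f x)]
        gcongr
        exact hf.abs_sub_le x y
      have h4 := _root_.abs_sub_le (log (f y) - log (f x)) ((f y - f x) / f x) (⟪q x, y - x⟫_ℝ / f x)
      rw [add_mul]
      linarith

end IsRegular

variable [FiniteDimensional ℝ E] [MeasurableSpace E] [BorelSpace E]

/-- Gaussian average of `f` around `x` at scale `s` (the heat semigroup at time `s ^ 2`). -/
noncomputable def heat (f : E → ℝ) (s : ℝ) (x : E) : ℝ :=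
  ∫ z, f (x + s • z) ∂(gauss E)

lemma heat_zero_left (f : E → ℝ) (x : E) : heat f 0 x = f x := by
  simp [heat]

lemma integrable_gauss_of_bounded {G : Type*} [NormedAddCommGroup G] [NormedSpace ℝ G]
    [SecondCountableTopology G] {g : E → G} (hg : Continuous g) {N : ℝ} (h : ∀ x, ‖g x‖ ≤ N) :
    Integrable g (gauss E) :=
  (integrable_const N).mono' hg.aestronglyMeasurable (Filter.Eventually.of_forall h)

lemma integral_integral_gauss {g : E → ℝ} (hg : Continuous g) {N : ℝ} (h : ∀ x, |g x| ≤ N)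
    (x : E) (t r : ℝ) :
    ∫ z, ∫ w, g (x + (t • z + r • w)) ∂(gauss E) ∂(gauss E)
      = ∫ z, g (x + √(t ^ 2 + r ^ 2) • z) ∂(gauss E) := by
  have h1 : Continuous fun p : E × E => t • p.1 + r • p.2 := by fun_prop
  have h2 : Continuous fun z : E => √(t ^ 2 + r ^ 2) • z := by fun_prop
  have h3 : Continuous fun y : E => g (x + y) := by fun_prop
  rw [← integral_map (φ := fun z : E => √(t ^ 2 + r ^ 2) • z) (f := fun y => g (x + y))
    h2.aemeasurable h3.aestronglyMeasurable, ← map_add_smul_prod_gauss,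
    integral_map h1.aemeasurable h3.aestronglyMeasurable, integral_prod]
  refine (integrable_const N).mono' ?_ (Filter.Eventually.of_forall fun p => h _)
  exact (h3.comp h1).aestronglyMeasurable

lemma heat_heat {f : E → ℝ} (hf : Continuous f) {N : ℝ} (h : ∀ x, |f x| ≤ N) (s r : ℝ) :
    heat (heat f s) r = heat f √(s ^ 2 + r ^ 2) := by
  ext x
  simp only [heat, add_assoc]
  rw [integral_integral_gauss hf h, add_comm (r ^ 2)]

/-- All the bounds are uniform in the base point, so averaging over translates keeps them. Having
the same `m`, `N`, `L` for every `s` makes the error constant uniform over all steps. -/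
lemma IsRegular.heat {m N L : ℝ} {f : E → ℝ} {q : E → E} (hf : IsRegular m N L f q) (s : ℝ) :
    IsRegular m N L (heat f s) fun x => ∫ z, q (x + s • z) ∂(gauss E) := by
  have hc := hf.continuous
  have hq := hf.continuous_slope
  have hfi : ∀ x, Integrable (fun z => f (x + s • z)) (gauss E) := fun x =>
    integrable_gauss_of_bounded (by fun_prop) fun z => hf.abs_le_upper _
  have hqi : ∀ x, Integrable (fun z => q (x + s • z)) (gauss E) := fun x =>
    integrable_gauss_of_bounded (by fun_prop) fun z => hf.norm_slope_le _
  refine ⟨hf.pos, fun x => ?_, fun x => ?_, fun x y => ?_, fun x => ?_, ?_, fun x y => ?_⟩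
  · have := integral_mono (integrable_const m) (hfi x) fun z => hf.le _
    simpa [BrascampLieb.heat] using this
  · have := integral_mono (hfi x) (integrable_const N) fun z => hf.ge _
    simpa [BrascampLieb.heat] using this
  · rw [BrascampLieb.heat, BrascampLieb.heat, ← integral_sub (hfi y) (hfi x)]
    have := norm_integral_le_of_norm_le_const (μ := gauss E) (C := L * ‖y - x‖)
      (f := fun z => f (y + s • z) - f (x + s • z)) (Filter.Eventually.of_forall fun z => by
        have := hf.abs_sub_le (x + s • z) (y + s • z)
        rwa [add_sub_add_right_eq_sub] at this)
    simpa using this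
  · have := norm_integral_le_of_norm_le_const (μ := gauss E) (C := L)
      (f := fun z => q (x + s • z)) (Filter.Eventually.of_forall fun z => hf.norm_slope_le _)
    simpa using this
  · refine continuous_of_dominated (bound := fun _ => L) (fun x => ?_) (fun x => ?_)
      (integrable_const L) (Filter.Eventually.of_forall fun z => ?_)
    · exact (hqi x).aestronglyMeasurable
    · exact Filter.Eventually.of_forall fun z => hf.norm_slope_le _
    · fun_prop
  · have hin : ⟪∫ z, q (x + s • z) ∂(gauss E), y - x⟫_ℝ
        = ∫ z, ⟪q (x + s • z), y - x⟫_ℝ ∂(gauss E) := by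
      rw [real_inner_comm, ← integral_inner (hqi x)]
      simp only [real_inner_comm]
    rw [BrascampLieb.heat, BrascampLieb.heat, hin, ← integral_sub (hfi y) (hfi x),
      ← integral_sub (f := fun z => f (y + s • z) - f (x + s • z)) ((hfi y).sub (hfi x)) ((hqi x).inner_const _)]
    have := norm_integral_le_of_norm_le_const (μ := gauss E) (C := L * ‖y - x‖ ^ 2)
      (f := fun z => f (y + s • z) - f (x + s • z) - ⟪q (x + s • z), y - x⟫_ℝ)
      (Filter.Eventually.of_forall fun z => by
        have := hf.abs_expansion_le (x + s • z) (y + s • z)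
        rwa [add_sub_add_right_eq_sub] at this)
    simpa using this

end Heat

/-! ### Interpolation along the heat flow. -/

namespace IsGeometricDatum

variable {ι : Type*} [Fintype ι] {E : Type*} [NormedAddCommGroup E] [InnerProductSpace ℝ E]
  [FiniteDimensional ℝ E] {F : ι → Type*} [∀ i, NormedAddCommGroup (F i)]
  [∀ i, InnerProductSpace ℝ (F i)] [∀ i, FiniteDimensional ℝ (F i)]
  {B : ∀ i, E →ₗ[ℝ] F i} {c : ι → ℝ}
  [MeasurableSpace E] [BorelSpace E] [∀ i, MeasurableSpace (F i)] [∀ i, BorelSpace (F i)]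

/-- The interpolation between the two sides of the Brascamp-Lieb inequality. -/
noncomputable def interpolation (B : ∀ i, E →ₗ[ℝ] F i) (c : ι → ℝ) (f : ∀ i, F i → ℝ)
    (s t : ℝ) : ℝ :=
  ∫ z, exp (∑ i, c i * log (heat (f i) s (B i (t • z)))) ∂(gauss E)

/-- Split the outer Gaussian into independent parts of scales `t` and `r`, apply the small-scale
inequality to the inner average, and recognise its factors as the heat flow run further by `r ^ 2`.
-/
lemma interpolation_step (hB : IsGeometricDatum B c) {m N L : ι → ℝ} {f : ∀ i, F i → ℝ}
    {q : ∀ i, F i → F i} (hf : ∀ i, IsRegular (m i) (N i) (L i) (f i) (q i)) (s t : ℝ) {r : ℝ}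
    (hr : 0 ≤ r) (hr1 : r ≤ 1) :
    interpolation B c f s √(t ^ 2 + r ^ 2)
      ≤ exp (driftConst E (∑ i, c i * (L i / m i + L i ^ 2 / m i ^ 2)) * r ^ 4)
        * interpolation B c f √(s ^ 2 + r ^ 2) t := by
  have hreg : ∀ s i, IsRegular (m i) (N i) (L i) (heat (f i) s) _ := fun s i => (hf i).heat s
  have hBc : ∀ i, Continuous (B i) := fun i => (B i).continuous_of_finiteDimensional
  have hcont : ∀ s, Continuous fun y : E => exp (∑ i, c i * log (heat (f i) s (B i y))) := by
    intro s
    have h1 : ∀ i, Continuous fun y => log (heat (f i) s y) := fun i =>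
      (hreg s i).hasQuadraticExpansion_log.continuous
    have h2 : ∀ i, Continuous fun y => log (heat (f i) s (B i y)) := fun i => (h1 i).comp (hBc i)
    fun_prop
  have hbd : ∀ s, ∀ y : E, |exp (∑ i, c i * log (heat (f i) s (B i y)))|
      ≤ exp (∑ i, c i * log (N i)) := by
    intro s y
    rw [abs_of_pos (exp_pos _)]
    refine exp_le_exp.2 (Finset.sum_le_sum fun i _ => ?_)
    refine mul_le_mul_of_nonneg_left (log_le_log ?_ ((hreg s i).ge _)) (hB.nonneg i)
    exact (hreg s i).pos.trans_le ((hreg s i).le _)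
  have hstep := integral_integral_gauss (hcont s) (hbd s) 0 t r
  simp only [zero_add] at hstep
  rw [interpolation, ← hstep, interpolation, ← integral_const_mul]
  refine integral_mono_of_nonneg
    (Filter.Eventually.of_forall fun z => integral_nonneg fun w => (exp_pos _).le) ?_
    (Filter.Eventually.of_forall fun z => ?_)
  · refine (integrable_gauss_of_bounded (N := exp (∑ i, c i * log (N i))) ?_
      fun z => hbd _ _).const_mul _
    exact (hcont _).comp (continuous_const_smul t)
  · have h := hB.integral_exp_le_of_small
      (fun i => (hreg s i).hasQuadraticExpansion_log) (t • z) hr hr1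
    refine h.trans_eq ?_
    congr 1
    rw [exp_sum]
    refine Finset.prod_congr rfl fun i _ => ?_
    have hpos : ∀ s y, 0 < heat (f i) s y := fun s y => (hreg s i).pos.trans_le ((hreg s i).le _)
    simp only [exp_log (hpos _ _)]
    rw [mul_comm, exp_mul, exp_log (hpos _ _),
      ← heat_heat (hf i).continuous (hf i).abs_le_upper s r]
    rfl

lemma interpolation_le_of_small (hB : IsGeometricDatum B c) {m N L : ι → ℝ} {f : ∀ i, F i → ℝ}
    {q : ∀ i, F i → F i} (hf : ∀ i, IsRegular (m i) (N i) (L i) (f i) (q i)) {r : ℝ}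
    (hr : 0 ≤ r) (hr1 : r ≤ 1) (k : ℕ) (s : ℝ) :
    interpolation B c f s √(k * r ^ 2)
      ≤ exp (driftConst E (∑ i, c i * (L i / m i + L i ^ 2 / m i ^ 2)) * r ^ 4) ^ k
        * interpolation B c f √(s ^ 2 + k * r ^ 2) 0 := by
  induction k generalizing s with
  | zero =>
    -- Here `s` may be negative; the semigroup law with second scale `0` identifies the scales `|s|`
    -- and `s`.
    have : ∀ i x, heat (f i) √(s ^ 2) x = heat (f i) s x := by
      intro i x
      have h := congrFun (heat_heat (hf i).continuous (hf i).abs_le_upper s 0) x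
      simp only [ne_eq, OfNat.ofNat_ne_zero, not_false_eq_true, zero_pow, add_zero,
        heat_zero_left] at h
      exact h.symm
    simp [interpolation, this]
  | succ k ih =>
    have h1 := hB.interpolation_step hf s √(k * r ^ 2) hr hr1
    have h2 := ih √(s ^ 2 + r ^ 2)
    rw [Real.sq_sqrt (by positivity)] at h1 h2
    rw [show ((k + 1 : ℕ) : ℝ) * r ^ 2 = k * r ^ 2 + r ^ 2 by push_cast; ring]
    refine h1.trans ?_
    rw [pow_succ' (exp _), mul_assoc]
    refine mul_le_mul_of_nonneg_left ?_ (exp_pos _).le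
    rwa [show s ^ 2 + (k * r ^ 2 + r ^ 2) = s ^ 2 + r ^ 2 + k * r ^ 2 by ring]

/-- The geometric Brascamp-Lieb inequality for regular functions. -/
lemma integral_prod_rpow_le_of_isRegular (hB : IsGeometricDatum B c) {m N L : ι → ℝ}
    {f : ∀ i, F i → ℝ} {q : ∀ i, F i → F i}
    (hf : ∀ i, IsRegular (m i) (N i) (L i) (f i) (q i)) :
    ∫ v, ∏ i, f i (B i v) ^ c i ∂(gauss E) ≤ ∏ i, (∫ u, f i u ∂(gauss (F i))) ^ c i := by
  have hexp : ∀ {a b : ℝ}, 0 < a → exp (b * log a) = a ^ b := by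
    intro a b ha
    rw [rpow_def_of_pos ha, mul_comm]
  have hleft : interpolation B c f 0 1 = ∫ v, ∏ i, f i (B i v) ^ c i ∂(gauss E) := by
    rw [interpolation]
    congr 1 with v
    rw [exp_sum]
    refine Finset.prod_congr rfl fun i _ => ?_
    rw [one_smul, heat_zero_left, hexp ((hf i).pos.trans_le ((hf i).le _))]
  have hright : interpolation B c f 1 0 = ∏ i, (∫ u, f i u ∂(gauss (F i))) ^ c i := by
    have : ∀ i, heat (f i) 1 0 = ∫ u, f i u ∂(gauss (F i)) := fun i => by simp [heat]
    simp only [interpolation, zero_smul, map_zero, integral_const, probReal_univ, one_smul]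
    rw [exp_sum]
    refine Finset.prod_congr rfl fun i _ => ?_
    rw [hexp (((hf i).heat 1).pos.trans_le (((hf i).heat 1).le _)), this]
  rw [← hleft, ← hright]
  set C := driftConst E (∑ i, c i * (L i / m i + L i ^ 2 / m i ^ 2)) with hC
  have hlim : Filter.Tendsto (fun n : ℕ => exp (C * (1 / ((n : ℝ) + 1)))
      * interpolation B c f 1 0) Filter.atTop (nhds (interpolation B c f 1 0)) := by
    have h := ((tendsto_one_div_add_atTop_nhds_zero_nat (𝕜 := ℝ)).const_mul C)
    have h2 := ((continuous_exp.tendsto _).comp h).mul_const (interpolation B c f 1 0)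
    simpa using h2
  refine ge_of_tendsto' hlim fun n => ?_
  have hn : (0 : ℝ) < n + 1 := by positivity
  have hr2 : √(1 / ((n : ℝ) + 1)) ^ 2 = 1 / ((n : ℝ) + 1) := Real.sq_sqrt (by positivity)
  -- There are `n + 1` steps with `r ^ 2 = 1 / (n + 1)`, so the errors `C * r ^ 4` add up to `C / (n
  -- + 1)`.
  have h := hB.interpolation_le_of_small hf (r := √(1 / ((n : ℝ) + 1))) (sqrt_nonneg _)
    (Real.sqrt_le_one.2 (by rw [div_le_one hn]; linarith [n.cast_nonneg (α := ℝ)])) (n + 1) 0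
  have h1 : ((n + 1 : ℕ) : ℝ) * √(1 / ((n : ℝ) + 1)) ^ 2 = 1 := by
    rw [hr2]; push_cast; field_simp
  rw [h1, ← exp_nat_mul] at h
  simp only [Real.sqrt_one, ne_eq, OfNat.ofNat_ne_zero, not_false_eq_true, zero_pow,
    zero_add] at h
  refine h.trans_eq ?_
  congr 2
  rw [show √(1 / ((n : ℝ) + 1)) ^ 4 = (√(1 / ((n : ℝ) + 1)) ^ 2) ^ 2 by ring, hr2]
  rw [← hC]
  push_cast
  field_simp

end IsGeometricDatum

/-! ### Smooth compactly supported functions are regular after adding a constant. -/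

section Smooth

variable {E : Type*} [NormedAddCommGroup E] [InnerProductSpace ℝ E] [FiniteDimensional ℝ E]

lemma exists_isRegular_of_contDiff {g : E → ℝ} (hg : ContDiff ℝ 2 g) (hgs : HasCompactSupport g)
    (hg0 : ∀ x, 0 ≤ g x) {ε : ℝ} (hε : 0 < ε) :
    ∃ N L q, IsRegular ε N L (fun x => g x + ε) q := by
  obtain ⟨N, hN⟩ := hgs.exists_bound_of_continuous hg.continuous
  have hd : ContDiff ℝ 1 (fderiv ℝ g) := hg.fderiv_right (by norm_num)
  have hds : HasCompactSupport (fderiv ℝ g) := hgs.fderiv (𝕜 := ℝ)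
  obtain ⟨L₁, hL₁⟩ := hds.exists_bound_of_continuous hd.continuous
  obtain ⟨L₂, hL₂⟩ := hd.lipschitzWith_of_hasCompactSupport hds (by norm_num)
  have hdiff : Differentiable ℝ g := hg.differentiable (by norm_num)
  refine ⟨N + ε, max L₁ L₂, fun x => (InnerProductSpace.toDual ℝ E).symm (fderiv ℝ g x), hε,
    fun x => by linarith [hg0 x], fun x => ?_, fun x y => ?_, fun x => ?_, ?_, fun x y => ?_⟩
  · have := (le_abs_self _).trans (hN x)
    linarith
  · have h := convex_univ.norm_image_sub_le_of_norm_fderiv_le (𝕜 := ℝ) (fun z _ => hdiff z)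
      (fun z _ => (hL₁ z).trans (le_max_left L₁ L₂)) (Set.mem_univ x) (Set.mem_univ y)
    rwa [add_sub_add_right_eq_sub]
  · rw [LinearIsometryEquiv.norm_map]
    exact (hL₁ x).trans (le_max_left _ _)
  · exact (LinearIsometryEquiv.continuous _).comp hd.continuous
  · rw [add_sub_add_right_eq_sub, InnerProductSpace.toDual_symm_apply]
    -- On this ball the derivative differs from its value at `x` by at most `max L₁ L₂ * ‖y - x‖`;
    -- the mean value inequality gives the quadratic remainder.
    have h := (convex_closedBall x ‖y - x‖).norm_image_sub_le_of_norm_hasFDerivWithin_le'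
      (f := g) (f' := fderiv ℝ g) (φ := fderiv ℝ g x) (C := max L₁ L₂ * ‖y - x‖)
      (fun z _ => (hdiff z).hasFDerivAt.hasFDerivWithinAt) (fun z hz => ?_)
      (Metric.mem_closedBall_self (norm_nonneg _))
      (show y ∈ Metric.closedBall x ‖y - x‖ by rw [mem_closedBall_iff_norm])
    · rwa [mul_assoc, ← sq, Real.norm_eq_abs] at h
    · have h1 := hL₂.dist_le_mul z x
      rw [dist_eq_norm, dist_eq_norm] at h1
      rw [mem_closedBall_iff_norm] at hz
      refine h1.trans (mul_le_mul (le_max_right _ _) hz (norm_nonneg _) ?_)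
      exact L₂.2.trans (le_max_right _ _)

end Smooth

/-! ### Approximation of integrable functions by regular ones. -/

section Approximation

variable {E : Type*} [NormedAddCommGroup E] [InnerProductSpace ℝ E] [FiniteDimensional ℝ E]
  [MeasurableSpace E] [BorelSpace E]

lemma exists_contDiff_integral_sq_sub_le {f : E → ℝ} (hf : MemLp f 2 (gauss E)) {η : ℝ}
    (hη : 0 < η) :
    ∃ φ : E → ℝ, HasCompactSupport φ ∧ ContDiff ℝ 2 φ ∧ MemLp φ 2 (gauss E) ∧
      eLpNorm (φ - f) 2 (gauss E) ≤ ENNReal.ofReal η ∧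
      ∫ x, (φ x - f x) ^ 2 ∂(gauss E) ≤ η ^ 2 := by
  obtain ⟨φ, hφs, hφ, hle⟩ := hf.exist_eLpNorm_sub_le (by norm_num) (by norm_num) hη
  have hφm : MemLp φ 2 (gauss E) := hφ.continuous.memLp_of_hasCompactSupport hφs
  rw [eLpNorm_sub_comm] at hle
  refine ⟨φ, hφs, by exact_mod_cast contDiff_infty.1 hφ 2, hφm, hle, ?_⟩
  have hd := hφm.sub hf
  rw [hd.eLpNorm_eq_integral_rpow_norm (by norm_num) (by norm_num),
    ENNReal.ofReal_le_ofReal_iff hη.le] at hle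
  have h0 : 0 ≤ ∫ x, (φ x - f x) ^ 2 ∂(gauss E) := integral_nonneg fun x => sq_nonneg _
  simp only [ENNReal.toReal_ofNat, Pi.sub_apply, Real.norm_eq_abs, rpow_ofNat, sq_abs] at hle
  rw [← Real.sqrt_le_left hη.le, Real.sqrt_eq_rpow]
  simpa using hle

/-- Weighted arithmetic-geometric mean. It turns `L²` closeness of square roots into closeness of
the integrals of the squares. -/
lemma abs_sq_sub_sq_le {η : ℝ} (hη : 0 < η) (b a : ℝ) :
    |b ^ 2 - a ^ 2| ≤ (1 + η⁻¹) * (b - a) ^ 2 + η * a ^ 2 := by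
  have key : 2 * |a * (b - a)| ≤ η⁻¹ * (b - a) ^ 2 + η * a ^ 2 := by
    have h : 0 ≤ η⁻¹ * (|b - a| - η * |a|) ^ 2 := by positivity
    have e : η⁻¹ * (|b - a| - η * |a|) ^ 2
        = η⁻¹ * |b - a| ^ 2 + η * |a| ^ 2 - 2 * (|a| * |b - a|) := by
      field_simp
      ring
    rw [e, sq_abs, sq_abs] at h
    rw [abs_mul]
    linarith
  rw [show b ^ 2 - a ^ 2 = (b - a) ^ 2 + 2 * (a * (b - a)) by ring]
  refine (abs_add_le _ _).trans ?_
  rw [abs_of_nonneg (sq_nonneg (b - a)), abs_mul 2, abs_of_pos (two_pos (α := ℝ))]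
  linarith

lemma abs_integral_sq_sub_integral_sq_le {α : Type*} [MeasurableSpace α] {μ : Measure α}
    {φ ψ : α → ℝ} (hφ : MemLp φ 2 μ) (hψ : MemLp ψ 2 μ) {η : ℝ} (hη : 0 < η) :
    |∫ x, φ x ^ 2 ∂μ - ∫ x, ψ x ^ 2 ∂μ|
      ≤ (1 + η⁻¹) * ∫ x, (φ x - ψ x) ^ 2 ∂μ + η * ∫ x, ψ x ^ 2 ∂μ := by
  have hd : Integrable (fun x => (φ x - ψ x) ^ 2) μ := (hφ.sub hψ).integrable_sq
  have hφ2 := hφ.integrable_sq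
  have hψ2 := hψ.integrable_sq
  rw [← integral_sub hφ2 hψ2, ← integral_const_mul, ← integral_const_mul,
    ← integral_add (hd.const_mul _) (hψ2.const_mul _)]
  exact abs_integral_le_integral_abs.trans
    (integral_mono (hφ2.sub hψ2).abs ((hd.const_mul _).add (hψ2.const_mul _))
      fun x => abs_sq_sub_sq_le hη _ _)

/-- Every nonnegative integrable function is an almost everywhere limit of regular functions whose
integrals converge. -/
lemma exists_seq_isRegular {f : E → ℝ} (hf0 : ∀ x, 0 ≤ f x) (hf : Integrable f (gauss E)) :
    ∃ g : ℕ → E → ℝ, (∀ n, ∃ m N L q, IsRegular m N L (g n) q) ∧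
      (∀ᵐ x ∂(gauss E), Tendsto (fun n => g n x) atTop (𝓝 (f x))) ∧
      Tendsto (fun n => ∫ x, g n x ∂(gauss E)) atTop (𝓝 (∫ x, f x ∂(gauss E))) := by
  have hsm : AEStronglyMeasurable (fun x => √(f x)) (gauss E) :=
    continuous_sqrt.comp_aestronglyMeasurable hf.aestronglyMeasurable
  -- Approximating the square root in `L²` and squaring keeps the approximants both smooth and
  -- nonnegative.
  have hs2 : MemLp (fun x => √(f x)) 2 (gauss E) := by
    rw [memLp_two_iff_integrable_sq hsm]
    simpa only [Real.sq_sqrt (hf0 _)] using hf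
  set η : ℕ → ℝ := fun n => 1 / ((n : ℝ) + 1) with hη
  have hηpos : ∀ n, 0 < η n := fun n => by positivity
  have hη0 : Tendsto η atTop (𝓝 0) := tendsto_one_div_add_atTop_nhds_zero_nat
  choose φ hφs hφ hφm hφL hφI using fun n => exists_contDiff_integral_sq_sub_le hs2 (hηpos n)
  have hL : Tendsto (fun n => eLpNorm (φ n - fun x => √(f x)) 2 (gauss E)) atTop (𝓝 0) := by
    refine tendsto_of_tendsto_of_tendsto_of_le_of_le tendsto_const_nhds ?_ (fun _ => zero_le) hφL
    simpa using ENNReal.tendsto_ofReal hη0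
  obtain ⟨ns, hns, hae⟩ := (tendstoInMeasure_of_tendsto_eLpNorm (by norm_num)
    (fun n => (hφm n).aestronglyMeasurable) hsm hL).exists_seq_tendsto_ae
  have hηns : Tendsto (fun n => η (ns n)) atTop (𝓝 0) := hη0.comp hns.tendsto_atTop
  refine ⟨fun n x => φ (ns n) x ^ 2 + η (ns n), fun n => ?_, ?_, ?_⟩
  · have hcs : HasCompactSupport fun x => φ (ns n) x ^ 2 :=
      (hφs (ns n)).comp_left (g := fun t : ℝ => t ^ 2) (by simp)
    obtain ⟨N, L, q, h⟩ := exists_isRegular_of_contDiff ((hφ (ns n)).pow 2) hcs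
      (fun x => sq_nonneg _) (hηpos (ns n))
    exact ⟨_, N, L, q, h⟩
  · filter_upwards [hae] with x hx
    have := (hx.pow 2).add hηns
    rwa [Real.sq_sqrt (hf0 x), add_zero] at this
  · have hφ2 : ∀ n, Integrable (fun x => φ n x ^ 2) (gauss E) := fun n => (hφm n).integrable_sq
    have hbound : ∀ n, |∫ x, φ n x ^ 2 ∂(gauss E) - ∫ x, f x ∂(gauss E)|
        ≤ η n ^ 2 + η n + η n * ∫ x, f x ∂(gauss E) := by
      intro n
      have h := abs_integral_sq_sub_integral_sq_le (hφm n) hs2 (hηpos n)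
      simp only [Real.sq_sqrt (hf0 _)] at h
      refine h.trans ?_
      have h1 := mul_le_mul_of_nonneg_left (hφI n)
        (show 0 ≤ 1 + (η n)⁻¹ by have := hηpos n; positivity)
      have h2 : (1 + (η n)⁻¹) * η n ^ 2 = η n ^ 2 + η n := by
        have := (hηpos n).ne'
        field_simp
      linarith
    have hlim : Tendsto (fun n => ∫ x, φ (ns n) x ^ 2 ∂(gauss E)) atTop
        (𝓝 (∫ x, f x ∂(gauss E))) := by
      rw [tendsto_iff_norm_sub_tendsto_zero]
      refine squeeze_zero (fun n => norm_nonneg _) (fun n => hbound (ns n)) ?_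
      have := ((hηns.pow 2).add hηns).add (hηns.mul_const (∫ x, f x ∂(gauss E)))
      simpa using this
    have := hlim.add hηns
    rw [add_zero] at this
    refine this.congr fun n => ?_
    rw [integral_add (hφ2 (ns n)) (integrable_const (η (ns n))), integral_const, probReal_univ,
      one_smul]

end Approximation

/-! ### The inequality for general functions. -/

namespace IsGeometricDatum

variable {ι : Type*} [Fintype ι] {E : Type*} [NormedAddCommGroup E] [InnerProductSpace ℝ E]
  [FiniteDimensional ℝ E] {F : ι → Type*} [∀ i, NormedAddCommGroup (F i)]
  [∀ i, InnerProductSpace ℝ (F i)] [∀ i, FiniteDimensional ℝ (F i)]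
  {B : ∀ i, E →ₗ[ℝ] F i} {c : ι → ℝ}
  [MeasurableSpace E] [BorelSpace E] [∀ i, MeasurableSpace (F i)] [∀ i, BorelSpace (F i)]

/-- Fatou's lemma on the left, convergence of the integrals on the right. Almost everywhere
convergence on `F i` pulls back to `E` because `B i` preserves the Gaussian measures. -/
lemma lintegral_prod_rpow_le_of_integrable (hB : IsGeometricDatum B c) {f : ∀ i, F i → ℝ}
    (hf0 : ∀ i u, 0 ≤ f i u) (hf : ∀ i, Integrable (f i) (gauss (F i))) :
    ∫⁻ v, ENNReal.ofReal (∏ i, f i (B i v) ^ c i) ∂(gauss E)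
      ≤ ENNReal.ofReal (∏ i, (∫ u, f i u ∂(gauss (F i))) ^ c i) := by
  choose g hg hae hint using fun i => exists_seq_isRegular (hf0 i) (hf i)
  have hBc : ∀ i, Continuous (B i) := fun i => (B i).continuous_of_finiteDimensional
  have hgc : ∀ i n, Continuous (g i n) := fun i n => by
    obtain ⟨m, N, L, q, h⟩ := hg i n
    exact h.continuous
  have hcont : ∀ n, Continuous fun v => ∏ i, g i n (B i v) ^ c i := fun n =>
    continuous_finsetProd _ fun i _ =>
      ((hgc i n).comp (hBc i)).rpow_const fun _ => Or.inr (hB.nonneg i)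
  have hlim : ∀ᵐ v ∂(gauss E), Tendsto (fun n => ENNReal.ofReal (∏ i, g i n (B i v) ^ c i)) atTop
      (𝓝 (ENNReal.ofReal (∏ i, f i (B i v) ^ c i))) := by
    have : ∀ᵐ v ∂(gauss E), ∀ i, Tendsto (fun n => g i n (B i v)) atTop (𝓝 (f i (B i v))) :=
      ae_all_iff.2 fun i => (hB.measurePreserving i).quasiMeasurePreserving.ae (hae i)
    filter_upwards [this] with v hv
    exact ENNReal.tendsto_ofReal
      (tendsto_finsetProd _ fun i _ => (hv i).rpow_const (Or.inr (hB.nonneg i)))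
  have hright : Tendsto (fun n => ENNReal.ofReal (∏ i, (∫ u, g i n u ∂(gauss (F i))) ^ c i)) atTop
      (𝓝 (ENNReal.ofReal (∏ i, (∫ u, f i u ∂(gauss (F i))) ^ c i))) :=
    ENNReal.tendsto_ofReal
      (tendsto_finsetProd _ fun i _ => (hint i).rpow_const (Or.inr (hB.nonneg i)))
  calc ∫⁻ v, ENNReal.ofReal (∏ i, f i (B i v) ^ c i) ∂(gauss E)
      = ∫⁻ v, liminf (fun n => ENNReal.ofReal (∏ i, g i n (B i v) ^ c i)) atTop ∂(gauss E) :=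
        lintegral_congr_ae (hlim.mono fun v hv => hv.liminf_eq.symm)
    _ ≤ liminf (fun n => ∫⁻ v, ENNReal.ofReal (∏ i, g i n (B i v) ^ c i) ∂(gauss E)) atTop :=
        lintegral_liminf_le fun n => (hcont n).measurable.ennreal_ofReal
    _ ≤ liminf (fun n => ENNReal.ofReal (∏ i, (∫ u, g i n u ∂(gauss (F i))) ^ c i)) atTop := by
        refine liminf_le_liminf (Eventually.of_forall fun n => ?_)
        choose m N L q h using fun i => hg i n
        have hpos : ∀ i u, 0 ≤ g i n u := fun i u => (h i).pos.le.trans ((h i).le u)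
        have hp : ∀ v, 0 ≤ ∏ i, g i n (B i v) ^ c i := fun v =>
          Finset.prod_nonneg fun i _ => rpow_nonneg (hpos i _) _
        have hi : Integrable (fun v => ∏ i, g i n (B i v) ^ c i) (gauss E) := by
          refine integrable_gauss_of_bounded (hcont n) (N := ∏ i, N i ^ c i) fun v => ?_
          rw [Real.norm_eq_abs, abs_of_nonneg (hp v)]
          exact Finset.prod_le_prod (fun i _ => rpow_nonneg (hpos i _) _) fun i _ =>
            rpow_le_rpow (hpos i _) ((h i).ge _) (hB.nonneg i)
        rw [← ofReal_integral_eq_lintegral_ofReal hi (Eventually.of_forall hp)]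
        exact ENNReal.ofReal_le_ofReal (hB.integral_prod_rpow_le_of_isRegular h)
    _ = _ := hright.liminf_eq

/-- The geometric Brascamp-Lieb inequality. -/
theorem lintegral_prod_rpow_le (hB : IsGeometricDatum B c) {f : ∀ i, F i → ℝ}
    (hf0 : ∀ i u, 0 ≤ f i u) (hfm : ∀ i, AEMeasurable (f i) (gauss (F i))) :
    ∫⁻ v, ENNReal.ofReal (∏ i, f i (B i v) ^ c i) ∂(gauss E)
      ≤ ∏ i, (∫⁻ u, ENNReal.ofReal (f i u) ∂(gauss (F i))) ^ c i := by
  classical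
  -- A vanishing integral is treated before an infinite one: if both occur, the right side is `0 * ∞
  -- = 0`, and the left side must be shown to vanish.
  by_cases h0 : ∃ j, 0 < c j ∧ ∫⁻ u, ENNReal.ofReal (f j u) ∂(gauss (F j)) = 0
  · obtain ⟨j, hj, hz⟩ := h0
    rw [lintegral_eq_zero_iff' (hfm j).ennreal_ofReal] at hz
    have hz' : ∀ᵐ u ∂(gauss (F j)), f j u = 0 :=
      hz.mono fun u hu => le_antisymm (ENNReal.ofReal_eq_zero.1 hu) (hf0 j u)
    have hae := (hB.measurePreserving j).quasiMeasurePreserving.ae hz'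
    have : ∫⁻ v, ENNReal.ofReal (∏ i, f i (B i v) ^ c i) ∂(gauss E) = 0 := by
      refine (lintegral_congr_ae (hae.mono fun v hv => ?_)).trans lintegral_zero
      rw [Finset.prod_eq_zero (Finset.mem_univ j) (by rw [hv, zero_rpow hj.ne'])]
      simp
    rw [this]
    exact zero_le
  push Not at h0
  have hne : ∀ i, (∫⁻ u, ENNReal.ofReal (f i u) ∂(gauss (F i))) ^ c i ≠ 0 := by
    intro i
    rcases (hB.nonneg i).eq_or_lt with hc | hc
    · simp [← hc]
    · exact fun h => h0 i hc ((ENNReal.rpow_eq_zero_iff_of_pos hc).1 h)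
  by_cases ht : ∃ j, 0 < c j ∧ ∫⁻ u, ENNReal.ofReal (f j u) ∂(gauss (F j)) = ⊤
  · obtain ⟨j, hj, ht⟩ := ht
    rw [← Finset.mul_prod_erase _ _ (Finset.mem_univ j), ht, ENNReal.top_rpow_of_pos hj,
      ENNReal.top_mul (Finset.prod_ne_zero_iff.2 fun i _ => hne i)]
    exact le_top
  push Not at ht
  -- A function with exponent `0` contributes the factor `1` but need not be integrable, so it is
  -- replaced by `0`; `0 ^ 0 = 1` keeps the products unchanged.
  set f' : ∀ i, F i → ℝ := fun i => if c i = 0 then 0 else f i with hf'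
  have hf'0 : ∀ i u, 0 ≤ f' i u := by
    intro i u
    simp only [hf']
    split_ifs
    · exact le_rfl
    · exact hf0 i u
  have hf'i : ∀ i, Integrable (f' i) (gauss (F i)) := by
    intro i
    simp only [hf']
    split_ifs with hc
    · exact integrable_zero _ _ _
    · refine ⟨(hfm i).aestronglyMeasurable, ?_⟩
      rw [hasFiniteIntegral_iff_ofReal (Eventually.of_forall (hf0 i))]
      exact lt_top_iff_ne_top.2 (ht i (lt_of_le_of_ne (hB.nonneg i) (Ne.symm hc)))
  have h := hB.lintegral_prod_rpow_le_of_integrable hf'0 hf'i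
  have hl : ∀ v, ∏ i, f' i (B i v) ^ c i = ∏ i, f i (B i v) ^ c i := by
    intro v
    refine Finset.prod_congr rfl fun i _ => ?_
    simp only [hf']
    split_ifs with hc
    · simp [hc]
    · rfl
  simp only [hl] at h
  refine h.trans_eq ?_
  rw [ENNReal.ofReal_prod_of_nonneg fun i _ => rpow_nonneg (integral_nonneg (hf'0 i)) _]
  refine Finset.prod_congr rfl fun i _ => ?_
  rw [← ENNReal.ofReal_rpow_of_nonneg (integral_nonneg (hf'0 i)) (hB.nonneg i),
    ofReal_integral_eq_lintegral_ofReal (hf'i i) (Eventually.of_forall (hf'0 i))]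
  simp only [hf']
  split_ifs with hc
  · simp [hc]
  · rfl

end IsGeometricDatum

/-! ### Extended-real entropy integrals and duality. -/

section Entropy

lemma mulLog_of_pos (a : ℝ) {b : ℝ} (hb : 0 < b) : mulLog a b = ((a * log b : ℝ) : EReal) := by
  rw [mulLog, ENNReal.log_ofReal_of_pos hb, EReal.coe_mul]

lemma mulLog_zero_left (b : ℝ) : mulLog 0 b = 0 := by
  simp [mulLog]

lemma mulLog_of_nonpos {a b : ℝ} (ha : 0 < a) (hb : b ≤ 0) : mulLog a b = ⊥ := by
  rw [mulLog, ENNReal.ofReal_eq_zero.2 hb, ENNReal.log_zero, EReal.coe_mul_bot_of_pos ha]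

lemma mulLog_self {a : ℝ} (ha : 0 ≤ a) : mulLog a a = ((a * log a : ℝ) : EReal) := by
  rcases ha.eq_or_lt with rfl | ha
  · simp [mulLog_zero_left]
  · exact mulLog_of_pos a ha

lemma mulLog_eq_coe {a b : ℝ} (ha : 0 ≤ a) (h : mulLog a b ≠ ⊥) :
    mulLog a b = ((a * log b : ℝ) : EReal) := by
  rcases ha.eq_or_lt with rfl | ha
  · simp [mulLog_zero_left]
  · refine mulLog_of_pos a (not_le.1 fun hb => h (mulLog_of_nonpos ha hb))

lemma pos_of_mulLog_ne_bot {a b : ℝ} (ha : 0 < a) (h : mulLog a b ≠ ⊥) : 0 < b :=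
  not_le.1 fun hb => h (mulLog_of_nonpos ha hb)

/-- Young's inequality for the entropy function. -/
lemma mul_log_le {a b : ℝ} (ha : 0 ≤ a) (hb : 0 < b) : a * log b ≤ a * log a - a + b := by
  rcases ha.eq_or_lt with rfl | ha
  · simpa using hb.le
  · have h := mul_le_mul_of_nonneg_left (log_le_sub_one_of_pos (show 0 < b / a by positivity)) ha.le
    rw [log_div hb.ne' ha.ne', mul_sub, mul_sub, mul_div_cancel₀ _ ha.ne'] at h
    linarith

lemma mulLog_le {a b : ℝ} (ha : 0 ≤ a) (hb : 0 ≤ b) :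
    mulLog a b ≤ ((a * log a - a + b : ℝ) : EReal) := by
  rcases hb.eq_or_lt with rfl | hb
  · rcases ha.eq_or_lt with rfl | ha
    · simp [mulLog_zero_left]
    · rw [mulLog_of_nonpos ha le_rfl]
      exact bot_le
  · rw [mulLog_of_pos a hb]
    exact EReal.coe_le_coe_iff.2 (mul_log_le ha hb)

lemma coe_finset_sum_real {ι : Type*} (s : Finset ι) (t : ι → ℝ) :
    ((∑ i ∈ s, t i : ℝ) : EReal) = ∑ i ∈ s, (t i : EReal) := by
  classical
  induction s using Finset.induction_on with
  | empty => simp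
  | insert i s hi ih => rw [Finset.sum_insert hi, Finset.sum_insert hi, EReal.coe_add, ih]

variable {Ω : Type*} [MeasurableSpace Ω] {μ : Measure Ω}

lemma eintegral_congr_ae {φ ψ : Ω → EReal} (h : φ =ᵐ[μ] ψ) : eintegral μ φ = eintegral μ ψ := by
  rw [eintegral, eintegral,
    lintegral_congr_ae (h.mono fun v hv => congrArg EReal.toENNReal hv),
    lintegral_congr_ae (h.mono fun v hv => congrArg (fun x => EReal.toENNReal (-x)) hv)]

lemma toENNReal_coe_real (x : ℝ) : (x : EReal).toENNReal = ENNReal.ofReal x := by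
  simp [EReal.toENNReal]

lemma eintegral_coe {φ : Ω → ℝ} (hφ : Integrable φ μ) :
    eintegral μ (fun v => (φ v : EReal)) = ((∫ v, φ v ∂μ : ℝ) : EReal) := by
  have h1 : ∫⁻ v, ENNReal.ofReal (φ v) ∂μ ≠ ⊤ := hφ.lintegral_lt_top.ne
  have h2 : ∫⁻ v, ENNReal.ofReal (-φ v) ∂μ ≠ ⊤ := hφ.neg.lintegral_lt_top.ne
  simp only [eintegral, ← EReal.coe_neg, toENNReal_coe_real]
  rw [integral_eq_lintegral_pos_part_sub_lintegral_neg_part hφ, EReal.coe_sub,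
    EReal.coe_ennreal_toReal h1, EReal.coe_ennreal_toReal h2]

lemma integrable_of_lintegral_ofReal_ne_top {φ : Ω → ℝ} (hm : AEMeasurable φ μ)
    (hpos : ∫⁻ v, ENNReal.ofReal (φ v) ∂μ ≠ ⊤) (hneg : ∫⁻ v, ENNReal.ofReal (-φ v) ∂μ ≠ ⊤) :
    Integrable φ μ := by
  refine ⟨hm.aestronglyMeasurable, ?_⟩
  have hle : ∫⁻ v, ‖φ v‖ₑ ∂μ
      ≤ ∫⁻ v, (ENNReal.ofReal (φ v) + ENNReal.ofReal (-φ v)) ∂μ := by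
    refine lintegral_mono fun v => ?_
    rw [← ofReal_norm, Real.norm_eq_abs]
    rcases le_total 0 (φ v) with h | h
    · rw [abs_of_nonneg h]
      exact le_self_add
    · rw [abs_of_nonpos h]
      exact le_add_self
  refine hle.trans_lt ?_
  rw [lintegral_add_left' hm.ennreal_ofReal]
  exact ENNReal.add_lt_top.2 ⟨hpos.lt_top, hneg.lt_top⟩

lemma eintegral_eq_bot {φ : Ω → EReal} (h : ∫⁻ v, (-φ v).toENNReal ∂μ = ⊤) :
    eintegral μ φ = ⊥ := by
  rw [eintegral, h, EReal.coe_ennreal_top, EReal.sub_top]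

lemma aemeasurable_mulLog {a b : Ω → ℝ} (ha : AEMeasurable a μ) (hb : AEMeasurable b μ) :
    AEMeasurable (fun v => mulLog (a v) (b v)) μ := by
  unfold mulLog
  exact ha.coe_real_ereal.mul (ENNReal.measurable_log.comp_aemeasurable hb.ennreal_ofReal)

/-- Young's inequality with `b = 1` gives `h log h ≥ h - 1 ≥ -1`, so on a probability space only the
positive part could diverge. -/
lemma integrable_mul_log_self [IsProbabilityMeasure μ] {h : Ω → ℝ} (h0 : ∀ v, 0 ≤ h v)
    (hh : AEMeasurable h μ) (hent : eintegral μ (fun v => mulLog (h v) (h v)) ≠ ⊤) :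
    Integrable (fun v => h v * log (h v)) μ := by
  simp only [mulLog_self (h0 _), eintegral, ← EReal.coe_neg, toENNReal_coe_real] at hent
  have hneg : ∫⁻ v, ENNReal.ofReal (-(h v * log (h v))) ∂μ ≠ ⊤ := by
    refine ne_top_of_le_ne_top ENNReal.one_ne_top
      ((lintegral_mono (g := fun _ => 1) fun v => ?_).trans_eq (by simp))
    have := mul_log_le (h0 v) one_pos
    rw [log_one, mul_zero] at this
    rw [← ENNReal.ofReal_one]
    exact ENNReal.ofReal_le_ofReal (by linarith [h0 v])
  have hpos : ∫⁻ v, ENNReal.ofReal (h v * log (h v)) ∂μ ≠ ⊤ := by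
    intro ht
    rw [ht, EReal.coe_ennreal_top] at hent
    lift ∫⁻ v, ENNReal.ofReal (-(h v * log (h v))) ∂μ to NNReal using hneg with r
    exact hent (EReal.top_sub_coe r)
  exact integrable_of_lintegral_ofReal_ne_top
    (hh.mul (measurable_log.comp_aemeasurable hh)) hpos hneg

/-- By Young's inequality the positive part is dominated by the positive part of `h log h` plus `g`.
-/
lemma lintegral_mulLog_ne_top {h g : Ω → ℝ} (h0 : ∀ v, 0 ≤ h v) (g0 : ∀ v, 0 ≤ g v)
    (hent : Integrable (fun v => h v * log (h v)) μ)
    (hg : ∫⁻ v, ENNReal.ofReal (g v) ∂μ ≠ ⊤) :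
    ∫⁻ v, (mulLog (h v) (g v)).toENNReal ∂μ ≠ ⊤ := by
  have hle : ∫⁻ v, (mulLog (h v) (g v)).toENNReal ∂μ
      ≤ ∫⁻ v, (ENNReal.ofReal (h v * log (h v)) + ENNReal.ofReal (g v)) ∂μ := by
    refine lintegral_mono fun v => ?_
    refine (EReal.toENNReal_le_toENNReal (mulLog_le (h0 v) (g0 v))).trans ?_
    rw [toENNReal_coe_real]
    exact (ENNReal.ofReal_le_ofReal (by linarith [h0 v])).trans ENNReal.ofReal_add_le
  refine ne_top_of_le_ne_top ?_ hle
  rw [lintegral_add_left' hent.aemeasurable.ennreal_ofReal]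
  exact ENNReal.add_ne_top.2 ⟨hent.lintegral_lt_top.ne, hg⟩

lemma integrable_mul_log {h g : Ω → ℝ} (h0 : ∀ v, 0 ≤ h v) (hh : AEMeasurable h μ)
    (hg : AEMeasurable g μ) (hpos : ∫⁻ v, (mulLog (h v) (g v)).toENNReal ∂μ ≠ ⊤)
    (hneg : ∫⁻ v, (-mulLog (h v) (g v)).toENNReal ∂μ ≠ ⊤) :
    (∀ᵐ v ∂μ, mulLog (h v) (g v) ≠ ⊥) ∧ Integrable (fun v => h v * log (g v)) μ ∧
      eintegral μ (fun v => mulLog (h v) (g v)) = ((∫ v, h v * log (g v) ∂μ : ℝ) : EReal) := by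
  have hm := aemeasurable_mulLog hh hg
  have hbot : ∀ᵐ v ∂μ, mulLog (h v) (g v) ≠ ⊥ := by
    refine (ae_lt_top' hm.neg.ereal_toENNReal hneg).mono fun v hv hb => ?_
    rw [Pi.neg_apply, hb, EReal.neg_bot, EReal.toENNReal_top] at hv
    exact lt_irrefl _ hv
  have heq : (fun v => mulLog (h v) (g v)) =ᵐ[μ] fun v => ((h v * log (g v) : ℝ) : EReal) :=
    hbot.mono fun v hv => mulLog_eq_coe (h0 v) hv
  have hi : Integrable (fun v => h v * log (g v)) μ := by
    rw [lintegral_congr_ae (heq.mono fun v hv => congrArg EReal.toENNReal hv)] at hpos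
    rw [lintegral_congr_ae (heq.mono fun v hv => congrArg (fun x => EReal.toENNReal (-x)) hv)]
      at hneg
    simp only [← EReal.coe_neg, toENNReal_coe_real] at hpos hneg
    exact integrable_of_lintegral_ofReal_ne_top
      (hh.mul (measurable_log.comp_aemeasurable hg)) hpos hneg
  exact ⟨hbot, hi, (eintegral_congr_ae heq).trans (eintegral_coe hi)⟩

/-- The entropy inequality dual to an inequality of Brascamp-Lieb type. -/
theorem sum_mul_eintegral_mulLog_sub_log_le [IsProbabilityMeasure μ] {ι : Type*} [Fintype ι]
    {c : ι → ℝ} (hc : ∀ i, 0 ≤ c i) {g : ι → Ω → ℝ} (hg0 : ∀ i v, 0 ≤ g i v)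
    (hgm : ∀ i, AEMeasurable (g i) μ)
    (hBL : ∫⁻ v, ENNReal.ofReal (∏ i, g i v ^ c i) ∂μ
      ≤ ∏ i, (∫⁻ v, ENNReal.ofReal (g i v) ∂μ) ^ c i)
    {h : Ω → ℝ} (h0 : ∀ v, 0 ≤ h v) (hi : Integrable h μ) (h1 : ∫ v, h v ∂μ = 1) :
    ∑ i, (c i : EReal) * (eintegral μ (fun v => mulLog (h v) (g i v))
        - ENNReal.log (∫⁻ v, ENNReal.ofReal (g i v) ∂μ))
      ≤ eintegral μ (fun v => mulLog (h v) (h v)) := by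
  classical
  by_cases hent : eintegral μ (fun v => mulLog (h v) (h v)) = ⊤
  · rw [hent]
    exact le_top
  have hhlog := integrable_mul_log_self h0 hi.aemeasurable hent
  set a : ι → ℝ≥0∞ := fun i => ∫⁻ v, ENNReal.ofReal (g i v) ∂μ with ha
  -- In these cases the `j`-th term is `⊥`, and in `EReal` a single `⊥` makes the whole sum `⊥`,
  -- even beside `⊤`.
  by_cases hbad : ∃ j, 0 < c j ∧ (a j = ⊤ ∨ ∫⁻ v, (-mulLog (h v) (g j v)).toENNReal ∂μ = ⊤)
  · obtain ⟨j, hj, hbad⟩ := hbad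
    have hterm : (c j : EReal) * (eintegral μ (fun v => mulLog (h v) (g j v))
        - ENNReal.log (a j)) = ⊥ := by
      rcases hbad with hbad | hbad
      · rw [hbad, ENNReal.log_top, EReal.sub_top, EReal.coe_mul_bot_of_pos hj]
      · rw [eintegral_eq_bot hbad, EReal.bot_sub, EReal.coe_mul_bot_of_pos hj]
    rw [← Finset.add_sum_erase _ _ (Finset.mem_univ j), hterm, EReal.bot_add]
    exact bot_le
  push Not at hbad
  have hfin : ∀ i, 0 < c i → a i ≠ ⊤ := fun i hci => (hbad i hci).1
  have hmain := fun i (hci : 0 < c i) => integrable_mul_log h0 hi.aemeasurable (hgm i)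
    (lintegral_mulLog_ne_top h0 (hg0 i) hhlog (hfin i hci)) (hbad i hci).2
  have hbot : ∀ᵐ v ∂μ, ∀ i, 0 < c i → mulLog (h v) (g i v) ≠ ⊥ := by
    rw [ae_all_iff]
    intro i
    by_cases hci : 0 < c i
    · exact (hmain i hci).1.mono fun v hv _ => hv
    · exact Eventually.of_forall fun v hci' => absurd hci' hci
  -- If `g i` vanished almost everywhere, finiteness of the negative part would force `h = 0` almost
  -- everywhere, against `∫ h = 1`.
  have ha0 : ∀ i, 0 < c i → a i ≠ 0 := by
    intro i hci hz
    rw [ha, lintegral_eq_zero_iff' (hgm i).ennreal_ofReal] at hz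
    have hz0 : h =ᵐ[μ] 0 := by
      filter_upwards [hz, hbot] with v hv hv2
      by_contra hne
      have hpos := pos_of_mulLog_ne_bot (lt_of_le_of_ne (h0 v) (Ne.symm hne)) (hv2 i hci)
      exact hpos.not_ge (ENNReal.ofReal_eq_zero.1 hv)
    rw [integral_congr_ae hz0] at h1
    simp at h1
  have hapos : ∀ i, 0 < c i → 0 < (a i).toReal := fun i hci =>
    ENNReal.toReal_pos (ha0 i hci) (hfin i hci)
  set t : ι → ℝ := fun i => if 0 < c i then c i * ∫ v, h v * log (g i v) ∂μ else 0 with ht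
  have hc0 : ∀ i, ¬ 0 < c i → c i = 0 := fun i hci => le_antisymm (not_lt.1 hci) (hc i)
  have hterm : ∀ i, (c i : EReal) * (eintegral μ (fun v => mulLog (h v) (g i v))
      - ENNReal.log (a i)) = ((t i - c i * log (a i).toReal : ℝ) : EReal) := by
    intro i
    by_cases hci : 0 < c i
    · rw [(hmain i hci).2.2, ENNReal.log_pos_real (ha0 i hci) (hfin i hci), ← EReal.coe_sub,
        ← EReal.coe_mul, ht]
      simp only [hci, if_true, mul_sub]
    · simp [ht, hc0 i hci]
  set Z : ℝ := ∏ i, (a i).toReal ^ c i with hZ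
  have hZf : ∀ i, 0 < (a i).toReal ^ c i := by
    intro i
    by_cases hci : 0 < c i
    · exact rpow_pos_of_pos (hapos i hci) _
    · simp [hc0 i hci]
  have hZpos : 0 < Z := Finset.prod_pos fun i _ => hZf i
  have hlogZ : log Z = ∑ i, c i * log (a i).toReal := by
    rw [hZ, log_prod fun i _ => (hZf i).ne']
    refine Finset.sum_congr rfl fun i _ => ?_
    by_cases hci : 0 < c i
    · exact log_rpow (hapos i hci) _
    · simp [hc0 i hci]
  have hprod : ∏ i, a i ^ c i = ENNReal.ofReal Z := by
    rw [hZ, ENNReal.ofReal_prod_of_nonneg fun i _ => (hZf i).le]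
    refine Finset.prod_congr rfl fun i _ => ?_
    by_cases hci : 0 < c i
    · rw [← ENNReal.ofReal_rpow_of_pos (hapos i hci), ENNReal.ofReal_toReal (hfin i hci)]
    · simp [hc0 i hci]
  set P : Ω → ℝ := fun v => ∏ i, g i v ^ c i with hP
  have hP0 : ∀ v, 0 ≤ P v := fun v => Finset.prod_nonneg fun i _ => rpow_nonneg (hg0 i v) _
  have hPm : AEMeasurable P μ := Finset.aemeasurable_fun_prod _ fun i _ => (hgm i).pow_const _
  have hPle : ∫⁻ v, ENNReal.ofReal (P v) ∂μ ≤ ENNReal.ofReal Z := hBL.trans_eq hprod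
  have hPi : Integrable P μ := by
    refine ⟨hPm.aestronglyMeasurable, ?_⟩
    rw [hasFiniteIntegral_iff_ofReal (Eventually.of_forall hP0)]
    exact hPle.trans_lt ENNReal.ofReal_lt_top
  have hPint : ∫ v, P v ∂μ ≤ Z := by
    rwa [← ofReal_integral_eq_lintegral_ofReal hPi (Eventually.of_forall hP0),
      ENNReal.ofReal_le_ofReal_iff hZpos.le] at hPle
  have htint : ∀ i, Integrable (fun v => c i * (h v * log (g i v))) μ := by
    intro i
    by_cases hci : 0 < c i
    · exact (hmain i hci).2.1.const_mul _
    · simp [hc0 i hci]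
  have htsum : ∑ i, t i = ∫ v, ∑ i, c i * (h v * log (g i v)) ∂μ := by
    rw [integral_finsetSum _ fun i _ => htint i]
    refine Finset.sum_congr rfl fun i _ => ?_
    by_cases hci : 0 < c i
    · simp only [ht, hci, if_true, integral_const_mul]
    · simp [ht, hc0 i hci]
  -- Young's inequality with `b = P v / Z`. Where `h v = 0` the left side is `0`; elsewhere every `g
  -- i v` with `c i > 0` is positive, so `log P` expands into a sum.
  have hpt : ∀ᵐ v ∂μ, ∑ i, c i * (h v * log (g i v))
      ≤ h v * log (h v) + (h v * log Z - h v) + P v / Z := by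
    filter_upwards [hbot] with v hv
    rcases (h0 v).eq_or_lt with hz | hpos
    · rw [← hz]
      have : 0 ≤ P v / Z := div_nonneg (hP0 v) hZpos.le
      simpa using this
    · have hgpos : ∀ i, 0 < c i → 0 < g i v := fun i hci => pos_of_mulLog_ne_bot hpos (hv i hci)
      have hPf : ∀ i, 0 < g i v ^ c i := by
        intro i
        by_cases hci : 0 < c i
        · exact rpow_pos_of_pos (hgpos i hci) _
        · simp [hc0 i hci]
      have hPpos : 0 < P v := Finset.prod_pos fun i _ => hPf i
      have hlogP : log (P v) = ∑ i, c i * log (g i v) := by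
        rw [hP, log_prod fun i _ => (hPf i).ne']
        refine Finset.sum_congr rfl fun i _ => ?_
        by_cases hci : 0 < c i
        · exact log_rpow (hgpos i hci) _
        · simp [hc0 i hci]
      have hy := mul_log_le hpos.le (div_pos hPpos hZpos)
      rw [log_div hPpos.ne' hZpos.ne', hlogP, mul_sub, Finset.mul_sum] at hy
      have hs : ∑ i, c i * (h v * log (g i v)) = ∑ i, h v * (c i * log (g i v)) :=
        Finset.sum_congr rfl fun i _ => by ring
      rw [hs]
      linarith
  have hlin : Integrable (fun v => h v * log Z - h v) μ := (hi.mul_const _).sub hi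
  have hreal : ∑ i, t i ≤ ∫ v, h v * log (h v) ∂μ + log Z := by
    rw [htsum]
    refine (integral_mono_ae (integrable_finsetSum _ fun i _ => htint i)
      ((hhlog.add hlin).add (hPi.div_const Z)) hpt).trans ?_
    have e := integral_add (hhlog.add hlin) (hPi.div_const Z)
    simp only [Pi.add_apply] at e ⊢
    rw [e, integral_add hhlog hlin, integral_sub (hi.mul_const _) hi, integral_mul_const,
      integral_div, h1]
    have : (∫ v, P v ∂μ) / Z ≤ 1 := (div_le_one hZpos).2 hPint
    linarith
  have hentropy : eintegral μ (fun v => mulLog (h v) (h v))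
      = ((∫ v, h v * log (h v) ∂μ : ℝ) : EReal) := by
    simp only [mulLog_self (h0 _)]
    exact eintegral_coe hhlog
  rw [hentropy, Finset.sum_congr rfl fun i _ => hterm i, ← coe_finset_sum_real,
    EReal.coe_le_coe_iff, Finset.sum_sub_distrib, ← hlogZ]
  linarith

end Entropy
end BrascampLieb

/-! ### The theorem for subspaces of Euclidean space. -/

theorem theorem4p2 (M K : ℕ) (H : Fin K → Submodule ℝ (EuclideanSpace ℝ (Fin M)))
    (B : (i : Fin K) → EuclideanSpace ℝ (Fin M) →ₗ[ℝ] H i)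
    (hB : ∀ i, B i ∘ₗ LinearMap.adjoint (B i) = LinearMap.id)
    (c : Fin K → ℝ) (hc : ∀ i, 0 ≤ c i)
    (hsum : ∑ i, c i • (LinearMap.adjoint (B i) ∘ₗ B i) = LinearMap.id)
    (f : (i : Fin K) → H i → ℝ) (hf : ∀ i u, 0 ≤ f i u)
    (hfm : ∀ i, AEMeasurable (f i) (BrascampLieb.gauss (H i))) :
    -- the geometric Brascamp-Lieb inequality
    (∫⁻ v, ENNReal.ofReal (∏ i, f i (B i v) ^ c i)
        ∂(BrascampLieb.gauss (EuclideanSpace ℝ (Fin M)))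
      ≤ ∏ i, (∫⁻ u, ENNReal.ofReal (f i u) ∂(BrascampLieb.gauss (H i))) ^ c i) ∧
    -- the entropy inequality
    ∀ h : EuclideanSpace ℝ (Fin M) → ℝ, (∀ v, 0 ≤ h v) →
      Integrable h (BrascampLieb.gauss (EuclideanSpace ℝ (Fin M))) →
      ∫ v, h v ∂(BrascampLieb.gauss (EuclideanSpace ℝ (Fin M))) = 1 →
      (∑ i, (c i : EReal) *
          (BrascampLieb.eintegral (BrascampLieb.gauss (EuclideanSpace ℝ (Fin M)))
              (fun v => BrascampLieb.mulLog (h v) (f i (B i v)))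
            - ENNReal.log (∫⁻ u, ENNReal.ofReal (f i u) ∂(BrascampLieb.gauss (H i))))
        ≤ BrascampLieb.eintegral (BrascampLieb.gauss (EuclideanSpace ℝ (Fin M)))
            (fun v => BrascampLieb.mulLog (h v) (h v))) ∧
      -- the integrals on the left are well defined, and not `+∞`, in the case of finite entropy
      (BrascampLieb.eintegral (BrascampLieb.gauss (EuclideanSpace ℝ (Fin M)))
            (fun v => BrascampLieb.mulLog (h v) (h v)) ≠ ⊤ →
        ∀ i, ∫⁻ u, ENNReal.ofReal (f i u) ∂(BrascampLieb.gauss (H i)) ≠ ⊤ →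
          ∫⁻ v, (BrascampLieb.mulLog (h v) (f i (B i v))).toENNReal
            ∂(BrascampLieb.gauss (EuclideanSpace ℝ (Fin M))) ≠ ⊤) := by
  have hdatum : BrascampLieb.IsGeometricDatum B c := ⟨hB, hc, hsum⟩
  -- Moves all integrals to the single probability space on which the duality argument runs.
  have hpres : ∀ i, ∫⁻ u, ENNReal.ofReal (f i u) ∂(BrascampLieb.gauss (H i))
      = ∫⁻ v, ENNReal.ofReal (f i (B i v))
        ∂(BrascampLieb.gauss (EuclideanSpace ℝ (Fin M))) := by
    intro i
    have hp := hdatum.measurePreserving i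
    rw [← hp.map_eq]
    exact lintegral_map' (by rw [hp.map_eq]; exact (hfm i).ennreal_ofReal) hp.aemeasurable
  have hgm : ∀ i, AEMeasurable (fun v => f i (B i v))
      (BrascampLieb.gauss (EuclideanSpace ℝ (Fin M))) := fun i =>
    (hfm i).comp_quasiMeasurePreserving (hdatum.measurePreserving i).quasiMeasurePreserving
  have hBL := hdatum.lintegral_prod_rpow_le hf hfm
  refine ⟨hBL, fun h h0 hi h1 => ⟨?_, fun hent i hfi => ?_⟩⟩
  · simp only [hpres] at hBL ⊢
    exact BrascampLieb.sum_mul_eintegral_mulLog_sub_log_le hc (fun i v => hf i (B i v)) hgm hBL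
      h0 hi h1
  · rw [hpres] at hfi
    exact BrascampLieb.lintegral_mulLog_ne_top h0 (fun v => hf i (B i v))
      (BrascampLieb.integrable_mul_log_self h0 hi.aemeasurable hent) hfi
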